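/- Let $N\ge 2$ and $0<r_1<r_2<R$. Write $B_r=\{x\in\mathbb{R}^N: |x|<r\}$ and $S=S_{r_1,r_2}=B_{r_2}\setminus\overline{B_{r_1}}$. Let $W^{1,1}_0(B_R)$ be the closure of $C^\infty_0(B_R)$ in the Sobolev space $W^{1,1}(B_R)$, and let \[ \mathrm{cap}_1(\overline{B_{r_2}};B_R)=\inf\Big\{\int_{B_R}|\nabla\varphi|\,dx\,:\,\varphi\in C^\infty_0(B_R),\ \varphi\ge 1\text{ on }\overline{B_{r_2}}\Big\}. \] Then \[ \sup_{\varphi\in W^{1,1}_0(B_R)\setminus\{0\}}\frac{\int_{S}|\varphi|\,dx}{\int_{B_R}|\nabla\varphi|\,dx}=\frac{|S|}{\mathrm{cap}_1(\overline{B_{r_2}};B_R)}=\frac{|S|}{\mathcal{H}^{N-1}(\partial B_{r_2})}. \] Moreover, define the Cheeger-type constant \[ h=\inf\Big\{\frac{\mathcal{H}^{N-1}(\partial E)}{|E\cap S|}\,:\,E\Subset B_R\text{ open with smooth boundary}\Big\}, \] where the ratio is understood to be $+\infty$ if $|E\cap S|=0$. Then \[ \inf_{\varphi\in C^\infty_0(B_R)\setminus\{0\}}\frac{\int_{B_R}|\nabla\varphi|\,dx}{\int_S|\varphi|\,dx}=h=\frac{\mathrm{cap}_1(\overline{B_{r_2}};B_R)}{|S|}=\frac{\mathcal{H}^{N-1}(\partial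 B_{r_2})}{|S|} \] (the ratio in the first infimum being $+\infty$ when $\int_S|\varphi|\,dx=0$), and the infimum defining $h$ is attained at $E=B_{r_2}$. -/

import Mathlib

open MeasureTheory Set TopologicalSpace
open scoped ENNReal ContDiff Distributions

/-- `G` is a weak gradient of `u` in the open set `Ω`, tested in every direction `v`. -/
def IsWeakGradient {N : ℕ} (Ω : Opens (EuclideanSpace ℝ (Fin N)))
    (u : EuclideanSpace ℝ (Fin N) → ℝ)
    (G : EuclideanSpace ℝ (Fin N) → EuclideanSpace ℝ (Fin N)) : Prop :=
  ∀ (φ : 𝓓(Ω, ℝ)) (v : EuclideanSpace ℝ (Fin N)),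
    ∫ x in (Ω : Set (EuclideanSpace ℝ (Fin N))), u x * fderiv ℝ φ x v =
      -∫ x in (Ω : Set (EuclideanSpace ℝ (Fin N))), inner ℝ (G x) v * φ x

/-- `u ∈ W^{1,p}(Ω)`, with weak gradient `G`. -/
structure MemSobolev {N : ℕ} (p : ℝ≥0∞) (Ω : Opens (EuclideanSpace ℝ (Fin N)))
    (u : EuclideanSpace ℝ (Fin N) → ℝ)
    (G : EuclideanSpace ℝ (Fin N) → EuclideanSpace ℝ (Fin N)) : Prop where
  memLp : MemLp u p (volume.restrict (Ω : Set (EuclideanSpace ℝ (Fin N))))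
  memLp_grad : MemLp G p (volume.restrict (Ω : Set (EuclideanSpace ℝ (Fin N))))
  isWeakGradient : IsWeakGradient Ω u G

/-- `u ∈ W^{1,p}_0(Ω)`, with weak gradient `G`: `u` belongs to the closure of `C_c^∞(Ω)` in
`W^{1,p}(Ω)`. -/
structure MemSobolevZero {N : ℕ} (p : ℝ≥0∞) (Ω : Opens (EuclideanSpace ℝ (Fin N)))
    (u : EuclideanSpace ℝ (Fin N) → ℝ)
    (G : EuclideanSpace ℝ (Fin N) → EuclideanSpace ℝ (Fin N)) : Prop extends
    MemSobolev p Ω u G where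
  mem_closure : ∀ ε : ℝ≥0∞, 0 < ε → ∃ φ : 𝓓(Ω, ℝ),
    eLpNorm (fun x => u x - φ x) p (volume.restrict (Ω : Set (EuclideanSpace ℝ (Fin N)))) +
      eLpNorm (fun x => G x - gradient φ x) p
        (volume.restrict (Ω : Set (EuclideanSpace ℝ (Fin N)))) < ε

/-- The `p`-capacity of `K` relative to the open set `Ω`. -/
noncomputable def relCapacity {N : ℕ} (p : ℝ) (K : Set (EuclideanSpace ℝ (Fin N)))
    (Ω : Opens (EuclideanSpace ℝ (Fin N))) : ℝ≥0∞ :=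
  ⨅ (φ : 𝓓(Ω, ℝ)) (_ : ∀ x ∈ K, 1 ≤ φ x),
    ∫⁻ x in (Ω : Set (EuclideanSpace ℝ (Fin N))), ‖gradient φ x‖ₑ ^ p

/-- The ball `B_R` centred at the origin, as an open set. -/
def centredBall (N : ℕ) (R : ℝ) : Opens (EuclideanSpace ℝ (Fin N)) :=
  ⟨Metric.ball 0 R, Metric.isOpen_ball⟩

/-- The spherical shell `S_{r₁,r₂} = {x : r₁ < |x| < r₂}`. -/
def shell (N : ℕ) (r₁ r₂ : ℝ) : Set (EuclideanSpace ℝ (Fin N)) :=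
  Metric.ball 0 r₂ \ Metric.closedBall 0 r₁

/-- The supremum of `∫_S |u| / ∫_Ω |∇u|` over the nonzero elements `u` of `W^{1,1}_0(Ω)`. -/
noncomputable def sharpConstant {N : ℕ} (Ω : Opens (EuclideanSpace ℝ (Fin N)))
    (S : Set (EuclideanSpace ℝ (Fin N))) : ℝ≥0∞ :=
  ⨆ (u : EuclideanSpace ℝ (Fin N) → ℝ)
    (G : EuclideanSpace ℝ (Fin N) → EuclideanSpace ℝ (Fin N))
    (_ : MemSobolevZero 1 Ω u G)
    (_ : ¬ u =ᵐ[volume.restrict (Ω : Set (EuclideanSpace ℝ (Fin N)))] 0),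
    (∫⁻ x in S, ‖u x‖ₑ) / ∫⁻ x in (Ω : Set (EuclideanSpace ℝ (Fin N))), ‖G x‖ₑ

/-- An open set with smooth boundary: near each boundary point it is the strict sublevel set of
a smooth function with nonvanishing differential. -/
def IsOpenSmoothBoundary {N : ℕ} (E : Set (EuclideanSpace ℝ (Fin N))) : Prop :=
  IsOpen E ∧ ∀ x ∈ frontier E, ∃ U : Set (EuclideanSpace ℝ (Fin N)), IsOpen U ∧ x ∈ U ∧
    ∃ f : EuclideanSpace ℝ (Fin N) → ℝ, ContDiffOn ℝ ∞ f U ∧ f x = 0 ∧ fderiv ℝ f x ≠ 0 ∧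
      E ∩ U = {y ∈ U | f y < 0}

/-- The open sets with smooth boundary that are compactly contained in `Ω`. -/
def IsCheegerAdmissible {N : ℕ} (Ω : Opens (EuclideanSpace ℝ (Fin N)))
    (E : Set (EuclideanSpace ℝ (Fin N))) : Prop :=
  IsOpenSmoothBoundary E ∧ IsCompact (closure E) ∧
    closure E ⊆ (Ω : Set (EuclideanSpace ℝ (Fin N)))

open Classical in
/-- The ratio `H^{N-1}(∂E) / |E ∩ S|`, equal to `+∞` when `|E ∩ S| = 0`. Here `μHE[d]` is the
`d`-dimensional Hausdorff measure normalized to agree with Lebesgue measure on `ℝ^d`. -/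
noncomputable def cheegerRatio {N : ℕ} (S E : Set (EuclideanSpace ℝ (Fin N))) : ℝ≥0∞ :=
  if volume (E ∩ S) = 0 then ⊤ else μHE[N - 1] (frontier E) / volume (E ∩ S)

/-- The Cheeger-type constant of `Ω` relative to `S`. -/
noncomputable def cheegerConstant {N : ℕ} (Ω : Opens (EuclideanSpace ℝ (Fin N)))
    (S : Set (EuclideanSpace ℝ (Fin N))) : ℝ≥0∞ :=
  ⨅ (E : Set (EuclideanSpace ℝ (Fin N))) (_ : IsCheegerAdmissible Ω E), cheegerRatio S E

/-!
The radial field `X x = w ‖x‖ • (x / ‖x‖)`, with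
`w s = max 0 (min s r₂ ^ N - r₁ ^ N) / (N * s ^ (N - 1))`, has divergence `1` in the shell `S` and
`0` elsewhere, and `‖X‖` is at most `K = (r₂ ^ N - r₁ ^ N) / (N * r₂ ^ (N - 1))`, with equality on
`∂B_{r₂}`; moreover `K = |S| / H^{N-1}(∂B_{r₂})`. Integrating a test function along rays is testing
against `X` and gives `∫_S |φ| ≤ K ∫ |∇φ|`. Every ray that meets `E ∩ S` leaves the bounded set `E`
farther out, so `E ∩ S` is covered by the shadows that the pieces of `∂E` cast towards the origin;
a small piece has a shadow of measure at most about `K` times its area, whence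
`|E ∩ S| ≤ K H^{N-1}(∂E)`. Smooth radial cutoffs of `B_{r₂}` show that its capacity is at most
`H^{N-1}(∂B_{r₂})`, so that all the constants coincide.
-/

theorem outerMeasure_le_mul_of_locally_le {X : Type*} [TopologicalSpace X]
    [SecondCountableTopology X] [MeasurableSpace X] [OpensMeasurableSpace X] {τ : OuterMeasure X}
    {ν : Measure X} {c : ℝ≥0∞} {A : Set X} (hA : MeasurableSet A)
    (h : ∀ x ∈ A, ∃ U ∈ nhds x, ∀ B ⊆ U, MeasurableSet B → τ B ≤ c * ν B) :
    τ A ≤ c * ν A := by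
  rcases A.eq_empty_or_nonempty with rfl | hne
  · simp
  choose! U hU hle using h
  obtain ⟨s, hsA, hs, hcov⟩ := countable_cover_nhdsWithin fun x hx =>
    mem_nhdsWithin_of_mem_nhds (interior_mem_nhds.2 (hU x hx))
  have hs_ne : s.Nonempty := by
    obtain ⟨x, hx, -⟩ := mem_iUnion₂.1 (hcov hne.some_mem)
    exact ⟨x, hx⟩
  obtain ⟨e, rfl⟩ := hs.exists_eq_range hs_ne
  let V : ℕ → Set X := fun i => interior (U (e i))
  let P : ℕ → Set X := fun i => A ∩ disjointed V i
  have hP : ∀ i, MeasurableSet (P i) := fun i =>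
    hA.inter (MeasurableSet.disjointed (fun _ => isOpen_interior.measurableSet) i)
  have hP_union : ⋃ i, P i = A := by
    rw [← inter_iUnion, iUnion_disjointed]
    exact inter_eq_left.2 (by simpa only [biUnion_range] using hcov)
  have hP_disj : Pairwise (Function.onFun Disjoint P) := fun i j hij =>
    (disjoint_disjointed V hij).mono inter_subset_right inter_subset_right
  have hPU : ∀ i, P i ⊆ U (e i) := fun i =>
    inter_subset_right.trans ((disjointed_subset V i).trans interior_subset)
  calc τ A = τ (⋃ i, P i) := by rw [hP_union]
    _ ≤ ∑' i, τ (P i) := measure_iUnion_le _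
    _ ≤ ∑' i, c * ν (P i) := ENNReal.tsum_le_tsum fun i =>
        hle _ (hsA (mem_range_self i)) _ (hPU i) (hP i)
    _ = c * ν A := by rw [ENNReal.tsum_mul_left, ← measure_iUnion hP_disj hP, hP_union]

theorem euclideanHausdorffMeasure_image_le_of_lipschitzOnWith {X Y : Type*} [EMetricSpace X]
    [MeasurableSpace X] [BorelSpace X] [EMetricSpace Y] [MeasurableSpace Y] [BorelSpace Y]
    {K : NNReal} {f : X → Y} {s : Set X} (hf : LipschitzOnWith K f s) (d : ℕ) :
    μHE[d] (f '' s) ≤ (K : ℝ≥0∞) ^ d * μHE[d] s := by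
  simp only [Measure.euclideanHausdorffMeasure_def, Measure.smul_apply, ENNReal.smul_def,
    smul_eq_mul]
  rw [mul_left_comm]
  gcongr
  simpa using hf.hausdorffMeasure_image_le (Nat.cast_nonneg d)

/-! ### The surface measure of the sphere -/

/-- The gnomonic (central) projection of the half-space `⟪u, x⟫ > 0` onto the hyperplane
`⟪u, x⟫ = 1`. -/
noncomputable def gnomonicProj {E : Type*} [NormedAddCommGroup E] [InnerProductSpace ℝ E]
    (u x : E) : E :=
  (inner ℝ u x)⁻¹ • x

section GnomonicProj

variable {E : Type*} [NormedAddCommGroup E] [InnerProductSpace ℝ E] {u x : E}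

theorem inner_gnomonicProj (hx : inner ℝ u x ≠ 0) : inner ℝ u (gnomonicProj u x) = 1 := by
  rw [gnomonicProj, inner_smul_right, inv_mul_cancel₀ hx]

theorem gnomonicProj_smul {t : ℝ} (ht : t ≠ 0) : gnomonicProj u (t • x) = gnomonicProj u x := by
  rw [gnomonicProj, gnomonicProj, inner_smul_right, smul_smul]
  congr 1
  field_simp

theorem gnomonicProj_eq_self (hx : inner ℝ u x = 1) : gnomonicProj u x = x := by
  rw [gnomonicProj, hx, inv_one, one_smul]

theorem inv_norm_smul_gnomonicProj (hx : 0 < inner ℝ u x) :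
    ‖gnomonicProj u x‖⁻¹ • gnomonicProj u x = ‖x‖⁻¹ • x := by
  rw [gnomonicProj, norm_smul, Real.norm_of_nonneg (inv_nonneg.2 hx.le), smul_smul]
  congr 1
  field_simp

theorem one_le_norm_of_inner_eq_one (hu : ‖u‖ = 1) (hx : inner ℝ u x = 1) : 1 ≤ ‖x‖ := by
  simpa [hx, hu] using real_inner_le_norm u x

theorem hasStrictFDerivAt_gnomonicProj (hu : ‖u‖ = 1) :
    HasStrictFDerivAt (gnomonicProj u) ((ℝ ∙ u)ᗮ.starProjection) u := by
  have hinner : HasStrictFDerivAt (fun x : E => inner ℝ u x) (innerSL ℝ u) u :=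
    (innerSL ℝ u).hasStrictFDerivAt
  have huu : inner ℝ u u = (1 : ℝ) := by simp [hu]
  have hinv : HasStrictDerivAt (fun t : ℝ => t⁻¹) (-1) (inner ℝ u u) := by
    rw [huu]
    simpa using hasStrictDerivAt_inv (one_ne_zero (α := ℝ))
  refine ((hinv.comp_hasStrictFDerivAt u hinner).smul (hasStrictFDerivAt_id u)).congr_fderiv ?_
  ext v
  simp [Submodule.starProjection_orthogonal_val, Submodule.starProjection_unit_singleton ℝ hu, hu,
    sub_eq_add_neg]

theorem exists_lipschitzOnWith_gnomonicProj (hu : ‖u‖ = 1) {K : NNReal} (hK : 1 < K) :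
    ∃ s ∈ nhds u, LipschitzOnWith K (gnomonicProj u) s :=
  (hasStrictFDerivAt_gnomonicProj hu).exists_lipschitzOnWith_of_nnnorm_lt K
    (lt_of_le_of_lt (Submodule.starProjection_norm_le _) hK)

end GnomonicProj

theorem le_of_forall_one_lt_le_pow_mul (k : ℕ) {a b : ℝ≥0∞}
    (h : ∀ c : NNReal, 1 < c → a ≤ c ^ k * b) : a ≤ b := by
  rcases eq_or_ne b ⊤ with rfl | hb
  · exact le_top
  have hcont : Continuous fun c : NNReal => (c : ℝ≥0∞) ^ k := by fun_prop
  have hlim : Filter.Tendsto (fun c : NNReal => (c : ℝ≥0∞) ^ k * b) (nhdsWithin 1 (Ioi 1))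
      (nhds (((1 : NNReal) : ℝ≥0∞) ^ k * b)) :=
    (ENNReal.Tendsto.mul_const (hcont.tendsto 1) (Or.inr hb)).mono_left nhdsWithin_le_nhds
  simpa using ge_of_tendsto hlim (eventually_nhdsWithin_of_forall h)

theorem lintegral_Ioo_pow (n : ℕ) {a b : ℝ} (ha : 0 ≤ a) (hb : 0 ≤ b) :
    ∫⁻ t in Ioo a b, ENNReal.ofReal (t ^ n) =
      ENNReal.ofReal ((b ^ (n + 1) - a ^ (n + 1)) / (n + 1)) := by
  rcases le_total b a with h | h
  · have hpow : b ^ (n + 1) ≤ a ^ (n + 1) := pow_le_pow_left₀ hb h _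
    rw [Ioo_eq_empty (not_lt.2 h), Measure.restrict_empty, lintegral_zero_measure,
      ENNReal.ofReal_of_nonpos (div_nonpos_of_nonpos_of_nonneg (by linarith) (by positivity))]
  · rw [Measure.restrict_congr_set Ioo_ae_eq_Ioc, ← ofReal_integral_eq_lintegral_ofReal,
      ← intervalIntegral.integral_of_le h, integral_pow]
    · exact (Continuous.intervalIntegrable (by fun_prop) a b).1
    · filter_upwards [ae_restrict_mem measurableSet_Ioc] with t ht
      have : 0 < t := ha.trans_lt ht.1
      positivity

theorem norm_sub_sq_eq_norm_direction_sub_sq {F : Type*} [NormedAddCommGroup F]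
    [InnerProductSpace ℝ F] {x y : F} (hx : x ≠ 0) (hy : y ≠ 0) :
    ‖x - y‖ ^ 2 = (‖x‖ - ‖y‖) ^ 2 + ‖x‖ * ‖y‖ * ‖‖x‖⁻¹ • x - ‖y‖⁻¹ • y‖ ^ 2 := by
  have hx0 : ‖x‖ ≠ 0 := norm_ne_zero_iff.2 hx
  have hy0 : ‖y‖ ≠ 0 := norm_ne_zero_iff.2 hy
  simp only [norm_sub_sq_real, inner_smul_left, inner_smul_right, norm_smul, norm_inv, norm_norm,
    RCLike.conj_to_real, inv_mul_cancel₀ hx0, inv_mul_cancel₀ hy0]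
  field_simp
  ring

theorem lipschitzOnWith_inv_norm_smul {F : Type*} [NormedAddCommGroup F]
    [InnerProductSpace ℝ F] {a : NNReal} (ha : 0 < a) :
    LipschitzOnWith a⁻¹ (fun x : F => ‖x‖⁻¹ • x) {x | a ≤ ‖x‖} := by
  refine LipschitzOnWith.of_dist_le_mul fun x (hx : a ≤ ‖x‖) y (hy : a ≤ ‖y‖) => ?_
  have ha' : (0 : ℝ) < a := ha
  have hx0 : x ≠ 0 := norm_pos_iff.1 (ha'.trans_le hx)
  have hy0 : y ≠ 0 := norm_pos_iff.1 (ha'.trans_le hy)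
  rw [NNReal.coe_inv, dist_eq_norm, dist_eq_norm, le_inv_mul_iff₀ ha']
  refine (pow_le_pow_iff_left₀ (by positivity) (norm_nonneg _) two_ne_zero).1 ?_
  calc (a * ‖‖x‖⁻¹ • x - ‖y‖⁻¹ • y‖) ^ 2 = a * a * ‖‖x‖⁻¹ • x - ‖y‖⁻¹ • y‖ ^ 2 := by ring
    _ ≤ (‖x‖ - ‖y‖) ^ 2 + ‖x‖ * ‖y‖ * ‖‖x‖⁻¹ • x - ‖y‖⁻¹ • y‖ ^ 2 :=
        (mul_le_mul_of_nonneg_right (mul_le_mul hx hy ha'.le (norm_nonneg x)) (sq_nonneg _)).trans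
          (le_add_of_nonneg_left (sq_nonneg _))
    _ = ‖x - y‖ ^ 2 := (norm_sub_sq_eq_norm_direction_sub_sq hx0 hy0).symm

section Sphere

open scoped Pointwise

variable {E : Type*} [NormedAddCommGroup E] [InnerProductSpace ℝ E] {u : E}

theorem Ioo_zero_one_smul_eq {D : Set E} (hD : ∀ z ∈ D, inner ℝ u z = 1) :
    Ioo (0 : ℝ) 1 • D = {x | inner ℝ u x ∈ Ioo (0 : ℝ) 1 ∧ gnomonicProj u x ∈ D} := by
  ext x
  constructor
  · rintro ⟨t, ht, z, hz, rfl⟩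
    refine ⟨by simpa [inner_smul_right, hD z hz] using ht, ?_⟩
    simpa only [gnomonicProj_smul ht.1.ne', gnomonicProj_eq_self (hD z hz)] using hz
  · rintro ⟨hx, hxD⟩
    exact ⟨_, hx, _, hxD, by simp only [gnomonicProj, smul_inv_smul₀ hx.1.ne']⟩

theorem Ioo_zero_one_smul_inter_hyperplane {D : Set E} (hD : ∀ z ∈ D, inner ℝ u z = 1) {t : ℝ}
    (ht : t ∈ Ioo (0 : ℝ) 1) : Ioo (0 : ℝ) 1 • D ∩ {x | inner ℝ u x = t} = t • D := by
  ext x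
  constructor
  · rintro ⟨⟨s, -, z, hz, rfl⟩, hx⟩
    obtain rfl : s = t := by simpa [inner_smul_right, hD z hz] using hx
    exact smul_mem_smul_set hz
  · rintro ⟨z, hz, rfl⟩
    exact ⟨⟨t, ht, z, hz, rfl⟩, by simp [inner_smul_right, hD z hz]⟩

theorem Ioo_smul_subset_Ioo_smul_image_gnomonicProj (hu : ‖u‖ = 1) {A : Set E}
    (hA : A ⊆ Metric.sphere 0 1) (hAu : ∀ y ∈ A, 0 < inner ℝ u y) :
    Ioo (0 : ℝ) 1 • A ⊆ Ioo (0 : ℝ) 1 • gnomonicProj u '' A := by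
  rintro _ ⟨t, ht, y, hy, rfl⟩
  have hy0 := hAu y hy
  have hy1 : inner ℝ u y ≤ 1 := by
    simpa [hu, norm_eq_of_mem_sphere ⟨y, hA hy⟩] using real_inner_le_norm u y
  refine ⟨t * inner ℝ u y, ⟨mul_pos ht.1 hy0, ?_⟩, _, mem_image_of_mem _ hy, ?_⟩
  · exact (mul_le_of_le_one_right ht.1.le hy1).trans_lt ht.2
  · simp only [gnomonicProj, smul_smul]
    rw [mul_assoc, mul_inv_cancel₀ hy0.ne', mul_one]

theorem smul_Ioo_smul_image_gnomonicProj_subset {κ : ℝ} (hκ : 0 < κ) {A : Set E}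
    (hAu : ∀ y ∈ A, κ < inner ℝ u y) :
    κ • (Ioo (0 : ℝ) 1 • gnomonicProj u '' A) ⊆ Ioo (0 : ℝ) 1 • A := by
  rintro _ ⟨_, ⟨t, ht, _, ⟨y, hy, rfl⟩, rfl⟩, rfl⟩
  have hy0 : 0 < inner ℝ u y := hκ.trans (hAu y hy)
  refine ⟨t * (κ / inner ℝ u y), ⟨mul_pos ht.1 (div_pos hκ hy0), ?_⟩, y, hy, ?_⟩
  · exact mul_lt_one_of_nonneg_of_lt_one_left ht.1.le ht.2 ((div_lt_one hy0).2 (hAu y hy)).le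
  · simp only [gnomonicProj, smul_smul]
    ring_nf

theorem image_inv_norm_smul_image_gnomonicProj {A : Set E} (hA : A ⊆ Metric.sphere 0 1)
    (hAu : ∀ y ∈ A, 0 < inner ℝ u y) :
    (fun z : E => ‖z‖⁻¹ • z) '' (gnomonicProj u '' A) = A := by
  rw [image_image]
  refine (image_congr fun y hy => ?_).trans (image_id A)
  rw [inv_norm_smul_gnomonicProj (hAu y hy), norm_eq_of_mem_sphere ⟨y, hA hy⟩, inv_one, one_smul,
    id]

theorem image_gnomonicProj_eq {A : Set E} (hA : A ⊆ Metric.sphere 0 1)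
    (hAu : ∀ y ∈ A, 0 < inner ℝ u y) :
    gnomonicProj u '' A = {z | inner ℝ u z = 1 ∧ ‖z‖⁻¹ • z ∈ A} := by
  ext z
  constructor
  · rintro ⟨y, hy, rfl⟩
    rw [mem_ofPred, inner_gnomonicProj (hAu y hy).ne', inv_norm_smul_gnomonicProj (hAu y hy),
      norm_eq_of_mem_sphere ⟨y, hA hy⟩, inv_one, one_smul]
    exact ⟨rfl, hy⟩
  · rintro ⟨hz, hzA⟩
    have hz0 : z ≠ 0 := by
      rintro rfl
      simp at hz
    exact ⟨_, hzA, by rw [gnomonicProj_smul (by simpa using hz0), gnomonicProj_eq_self hz]⟩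

variable [MeasurableSpace E] [BorelSpace E]

theorem measurableSet_image_gnomonicProj {A : Set E} (hAm : MeasurableSet A)
    (hA : A ⊆ Metric.sphere 0 1) (hAu : ∀ y ∈ A, 0 < inner ℝ u y) :
    MeasurableSet (gnomonicProj u '' A) := by
  have hdir : Measurable fun z : E => ‖z‖⁻¹ • z := by fun_prop
  rw [image_gnomonicProj_eq hA hAu]
  exact (isClosed_eq (by fun_prop) continuous_const).measurableSet.inter (hdir hAm)

variable [FiniteDimensional ℝ E] {n : ℕ}

theorem volume_eq_lintegral_hyperplane_section (hn : Module.finrank ℝ E = n + 1) (hu : ‖u‖ = 1)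
    {T : Set E} (hT : MeasurableSet T) :
    volume T = ∫⁻ t : ℝ, μHE[n] (T ∩ {x | inner ℝ u x = t}) := by
  have hu0 : u ≠ 0 := norm_ne_zero_iff.1 (by simp [hu])
  have key := EuclideanGeometry.euclideanHausdorffMeasure_eq_lintegral (0 : E) hu0 hT
  rw [InnerProductSpace.euclideanHausdorffMeasure_eq_volume, hn, Nat.add_sub_cancel,
    ← ofReal_norm, hu, ENNReal.ofReal_one, one_mul] at key
  have hplane : ∀ t : ℝ, (AffineSubspace.mk' (t • u +ᵥ (0 : E)) (ℝ ∙ u)ᗮ : Set E) =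
      {x | inner ℝ u x = t} := fun t => by
    ext x
    rw [SetLike.mem_coe, AffineSubspace.mem_mk',
      Submodule.mem_orthogonal_singleton_iff_inner_right]
    simp [inner_sub_right, inner_smul_right, hu, sub_eq_zero]
  simpa only [hplane] using key

theorem mul_volume_Ioo_smul_eq (hn : Module.finrank ℝ E = n + 1) (hu : ‖u‖ = 1) {D : Set E}
    (hD : MeasurableSet D) (hDu : ∀ z ∈ D, inner ℝ u z = 1) :
    (n + 1 : ℕ) * volume (Ioo (0 : ℝ) 1 • D) = μHE[n] D := by
  have hcone : MeasurableSet (Ioo (0 : ℝ) 1 • D) := by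
    rw [Ioo_zero_one_smul_eq hDu]
    have hinner : Measurable fun x : E => inner ℝ u x := by fun_prop
    exact (hinner measurableSet_Ioo).inter ((hinner.inv.smul measurable_id) hD)
  have hslice : ∀ t : ℝ, μHE[n] (Ioo (0 : ℝ) 1 • D ∩ {x | inner ℝ u x = t}) =
      (Ioo (0 : ℝ) 1).indicator (fun t => ENNReal.ofReal (t ^ n) * μHE[n] D) t := by
    intro t
    by_cases ht : t ∈ Ioo (0 : ℝ) 1
    · rw [indicator_of_mem ht, Ioo_zero_one_smul_inter_hyperplane hDu ht,
        Measure.euclideanHausdorffMeasure_smul₀ n ht.1.ne', ENNReal.smul_def, smul_eq_mul,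
        ENNReal.ofReal_pow ht.1.le, ENNReal.coe_pow,
        ← enorm_eq_nnnorm, Real.enorm_of_nonneg ht.1.le]
    · rw [indicator_of_notMem ht, show Ioo (0 : ℝ) 1 • D ∩ {x | inner ℝ u x = t} = ∅ from ?_,
        measure_empty]
      rw [Ioo_zero_one_smul_eq hDu, eq_empty_iff_forall_notMem]
      rintro x ⟨⟨hx, -⟩, rfl⟩
      exact ht hx
  rw [volume_eq_lintegral_hyperplane_section hn hu hcone, lintegral_congr hslice,
    lintegral_indicator measurableSet_Ioo, lintegral_mul_const _ (by fun_prop),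
    lintegral_Ioo_pow n le_rfl zero_le_one, ← mul_assoc, ← ENNReal.ofReal_natCast,
    ← ENNReal.ofReal_mul (by positivity)]
  have : ((n + 1 : ℕ) : ℝ) * ((1 ^ (n + 1) - 0 ^ (n + 1)) / (n + 1)) = 1 := by
    push_cast
    field_simp
    simp
  rw [this, ENNReal.ofReal_one, one_mul]

-- Both measures are compared with the area of the flat gnomonic image `D` of `A`, which is `n + 1`
-- times the volume of the cone over `D`.
theorem euclideanHausdorffMeasure_comparable_toSphere (hn : Module.finrank ℝ E = n + 1)
    (hu : ‖u‖ = 1) {κ : ℝ} (hκ : 0 < κ) {K : NNReal} {A : Set (Metric.sphere (0 : E) 1)}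
    (hA : MeasurableSet A) (hAu : ∀ y ∈ A, κ < inner ℝ u (y : E))
    (hK : LipschitzOnWith K (gnomonicProj u) ((↑) '' A)) :
    μHE[n] A ≤ ENNReal.ofReal (κ⁻¹ ^ (n + 1)) * (volume : Measure E).toSphere A ∧
      (volume : Measure E).toSphere A ≤ K ^ n * μHE[n] A := by
  set A' : Set E := (↑) '' A
  set D : Set E := gnomonicProj u '' A'
  have hA'_sphere : A' ⊆ Metric.sphere 0 1 := Subtype.coe_image_subset _ _
  have hA'_inner : ∀ y ∈ A', κ < inner ℝ u y := forall_mem_image.2 hAu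
  have hA'_pos : ∀ y ∈ A', 0 < inner ℝ u y := fun y hy => hκ.trans (hA'_inner y hy)
  have hD_inner : ∀ z ∈ D, inner ℝ u z = 1 :=
    forall_mem_image.2 fun y hy => inner_gnomonicProj (hA'_pos y hy).ne'
  have hA' : MeasurableSet A' :=
    (MeasurableEmbedding.subtype_coe Metric.isClosed_sphere.measurableSet).measurableSet_image' hA
  have hHA : μHE[n] A = μHE[n] A' := (isometry_subtype_coe.euclideanHausdorffMeasure_image A).symm
  have hHD : (n + 1 : ℕ) * volume (Ioo (0 : ℝ) 1 • D) = μHE[n] D :=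
    mul_volume_Ioo_smul_eq hn hu (measurableSet_image_gnomonicProj hA' hA'_sphere hA'_pos) hD_inner
  rw [Measure.toSphere_apply' _ hA, hn, hHA]
  constructor
  · calc μHE[n] A' ≤ μHE[n] D := by
          nth_rw 1 [← image_inv_norm_smul_image_gnomonicProj hA'_sphere hA'_pos]
          have hLip : LipschitzOnWith 1 (fun z : E => ‖z‖⁻¹ • z) D :=
            (inv_one (G := NNReal) ▸ lipschitzOnWith_inv_norm_smul one_pos).mono fun z hz => by
              simpa using one_le_norm_of_inner_eq_one hu (hD_inner z hz)
          simpa using euclideanHausdorffMeasure_image_le_of_lipschitzOnWith hLip n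
      _ = (n + 1 : ℕ) * (ENNReal.ofReal (κ⁻¹ ^ (n + 1)) *
            volume (κ • (Ioo (0 : ℝ) 1 • D))) := by
          rw [Measure.addHaar_smul, hn, ← mul_assoc (ENNReal.ofReal _),
            ← ENNReal.ofReal_mul (by positivity), abs_of_pos (by positivity), ← mul_pow,
            inv_mul_cancel₀ hκ.ne', one_pow, ENNReal.ofReal_one, one_mul, hHD]
      _ ≤ ENNReal.ofReal (κ⁻¹ ^ (n + 1)) * ((n + 1 : ℕ) * volume (Ioo (0 : ℝ) 1 • A')) := by
          rw [mul_left_comm]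
          gcongr
          exact smul_Ioo_smul_image_gnomonicProj_subset hκ hA'_inner
  · calc (n + 1 : ℕ) * volume (Ioo (0 : ℝ) 1 • A')
        ≤ (n + 1 : ℕ) * volume (Ioo (0 : ℝ) 1 • D) := by
          exact mul_le_mul_right (measure_mono
            (Ioo_smul_subset_Ioo_smul_image_gnomonicProj hu hA'_sphere hA'_pos)) _
      _ ≤ K ^ n * μHE[n] A' :=
          hHD.trans_le (euclideanHausdorffMeasure_image_le_of_lipschitzOnWith hK n)

theorem exists_nhds_euclideanHausdorffMeasure_comparable_toSphere
    (hn : Module.finrank ℝ E = n + 1) {K : NNReal} (hK : 1 < K) (u : Metric.sphere (0 : E) 1) :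
    ∃ U ∈ nhds u, ∀ A ⊆ U, MeasurableSet A →
      μHE[n] A ≤ K ^ (n + 1) * (volume : Measure E).toSphere A ∧
        (volume : Measure E).toSphere A ≤ K ^ n * μHE[n] A := by
  have hu : ‖(u : E)‖ = 1 := norm_eq_of_mem_sphere u
  have hKinv : (K⁻¹ : ℝ) < 1 := inv_lt_one_of_one_lt₀ (mod_cast hK)
  obtain ⟨s, hs, hLip⟩ := exists_lipschitzOnWith_gnomonicProj hu hK
  have hcap : {y : Metric.sphere (0 : E) 1 | (K⁻¹ : ℝ) < inner ℝ (u : E) (y : E)} ∈ nhds u :=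
    (isOpen_lt continuous_const (by fun_prop)).mem_nhds (by simpa [hu] using hKinv)
  refine ⟨(↑) ⁻¹' s ∩ _, Filter.inter_mem (continuousAt_subtype_val.preimage_mem_nhds hs) hcap,
    fun A hA hAm => ?_⟩
  have h := euclideanHausdorffMeasure_comparable_toSphere hn hu
    (inv_pos.2 (NNReal.coe_pos.2 (one_pos.trans hK))) hAm (fun y hy => (hA hy).2)
    (hLip.mono (image_subset_iff.2 fun y hy => (hA hy).1))
  rwa [inv_inv, ← NNReal.coe_pow, ENNReal.ofReal_coe_nnreal, ENNReal.coe_pow] at h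

theorem toSphere_volume_eq_euclideanHausdorffMeasure (hn : Module.finrank ℝ E = n + 1) :
    (volume : Measure E).toSphere = μHE[n] := by
  ext A hA
  refine le_antisymm (le_of_forall_one_lt_le_pow_mul n fun K hK => ?_)
    (le_of_forall_one_lt_le_pow_mul (n + 1) fun K hK => ?_)
  · refine outerMeasure_le_mul_of_locally_le (τ := (volume : Measure E).toSphere.toOuterMeasure) hA
      fun u _ => ?_
    obtain ⟨U, hU, h⟩ := exists_nhds_euclideanHausdorffMeasure_comparable_toSphere hn hK u
    exact ⟨U, hU, fun B hBU hB => (h B hBU hB).2⟩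
  · refine outerMeasure_le_mul_of_locally_le
      (τ := (μHE[n] : Measure (Metric.sphere (0 : E) 1)).toOuterMeasure) hA fun u _ => ?_
    obtain ⟨U, hU, h⟩ := exists_nhds_euclideanHausdorffMeasure_comparable_toSphere hn hK u
    exact ⟨U, hU, fun B hBU hB => (h B hBU hB).1⟩

theorem euclideanHausdorffMeasure_sphere (hn : Module.finrank ℝ E = n + 1) {r : ℝ} (hr : 0 < r) :
    μHE[n] (Metric.sphere (0 : E) r) =
      ENNReal.ofReal (r ^ n) * (volume : Measure E).toSphere univ := by
  have hsphere : Metric.sphere (0 : E) r = r • Metric.sphere (0 : E) 1 := by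
    simp [smul_sphere' hr.ne', abs_of_pos hr]
  have hunit : μHE[n] (Metric.sphere (0 : E) 1) = (volume : Measure E).toSphere univ := by
    have h := (isometry_subtype_coe (s := Metric.sphere (0 : E) 1)).euclideanHausdorffMeasure_image
      (d := n) univ
    rwa [image_univ, Subtype.range_coe, ← toSphere_volume_eq_euclideanHausdorffMeasure hn] at h
  rw [hsphere, Measure.euclideanHausdorffMeasure_smul₀ n hr.ne', hunit, ENNReal.smul_def,
    smul_eq_mul, ENNReal.ofReal_pow hr.le, ENNReal.coe_pow, ← enorm_eq_nnnorm,
    Real.enorm_of_nonneg hr.le]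

theorem euclideanHausdorffMeasure_sphere_ne_zero (hn : Module.finrank ℝ E = n + 1) {r : ℝ}
    (hr : 0 < r) : μHE[n] (Metric.sphere (0 : E) r) ≠ 0 := by
  have : Nontrivial E := Module.nontrivial_of_finrank_pos (R := ℝ) (by omega)
  rw [euclideanHausdorffMeasure_sphere hn hr]
  exact mul_ne_zero (ENNReal.ofReal_pos.2 (by positivity)).ne'
    (Measure.measure_univ_ne_zero.2 (Measure.toSphere_ne_zero _))

theorem euclideanHausdorffMeasure_sphere_ne_top (hn : Module.finrank ℝ E = n + 1) {r : ℝ}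
    (hr : 0 < r) : μHE[n] (Metric.sphere (0 : E) r) ≠ ⊤ := by
  rw [euclideanHausdorffMeasure_sphere hn hr]
  exact ENNReal.mul_ne_top ENNReal.ofReal_ne_top (measure_ne_top _ _)

end Sphere

section Sector

open scoped Pointwise

variable {E : Type*} [NormedAddCommGroup E] [InnerProductSpace ℝ E]

theorem Ioo_smul_sphere_one_eq {a : ℝ} (ha : 0 ≤ a) (b : ℝ) :
    Ioo a b • Metric.sphere (0 : E) 1 = norm ⁻¹' Ioo a b := by
  ext x
  constructor
  · rintro ⟨t, ht, θ, hθ, rfl⟩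
    have ht0 : 0 ≤ t := ha.trans ht.1.le
    simpa [norm_smul, abs_of_nonneg ht0, mem_sphere_zero_iff_norm.1 hθ] using ht
  · intro hx
    have hx0 : ‖x‖ ≠ 0 := (ha.trans_lt hx.1).ne'
    exact ⟨‖x‖, hx, ‖x‖⁻¹ • x, by simp [norm_smul, hx0], smul_inv_smul₀ hx0 x⟩

variable [FiniteDimensional ℝ E] [MeasurableSpace E] [BorelSpace E] {n : ℕ}

theorem volume_Ioo_smul (hn : Module.finrank ℝ E = n + 1) {Θ : Set E}
    (hΘ : Θ ⊆ Metric.sphere 0 1) {a b : ℝ} (ha : 0 ≤ a) (hb : 0 ≤ b) :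
    volume (Ioo a b • Θ) =
      ENNReal.ofReal ((b ^ (n + 1) - a ^ (n + 1)) / (n + 1)) * μHE[n] Θ := by
  have hpolar := (volume : Measure E).measurePreserving_homeomorphUnitSphereProd
  rw [hn, Nat.add_sub_cancel, toSphere_volume_eq_euclideanHausdorffMeasure hn] at hpolar
  let Θ' : Set (Metric.sphere (0 : E) 1) := (↑) ⁻¹' Θ
  let I : Set (Ioi (0 : ℝ)) := (↑) ⁻¹' Ioo a b
  have hΘ' : μHE[n] Θ' = μHE[n] Θ := by
    rw [← isometry_subtype_coe.euclideanHausdorffMeasure_image,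
      Subtype.image_preimage_coe, inter_eq_right.2 hΘ]
  have hI : Measure.volumeIoiPow n I = ENNReal.ofReal ((b ^ (n + 1) - a ^ (n + 1)) / (n + 1)) := by
    rw [Measure.volumeIoiPow, withDensity_apply _ (measurable_subtype_coe measurableSet_Ioo),
      setLIntegral_subtype measurableSet_Ioi _ fun t : ℝ => ENNReal.ofReal (t ^ n),
      Subtype.image_preimage_coe, inter_eq_right.2 (Ioo_subset_Ioi_self.trans (Ioi_subset_Ioi ha)),
      lintegral_Ioo_pow n ha hb]
  have hsector : (↑) '' (homeomorphUnitSphereProd E ⁻¹' Θ' ×ˢ I) = Ioo a b • Θ := by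
    ext x
    constructor
    · rintro ⟨⟨y, hy⟩, ⟨hyΘ, hyI⟩, rfl⟩
      simp only [Θ', I, mem_preimage, homeomorphUnitSphereProd_apply_fst_coe,
        homeomorphUnitSphereProd_apply_snd_coe] at hyΘ hyI
      exact ⟨‖y‖, hyI, ‖y‖⁻¹ • y, hyΘ, smul_inv_smul₀ (norm_ne_zero_iff.2 hy) y⟩
    · rintro ⟨t, ht, θ, hθ, rfl⟩
      have ht0 : 0 < t := ha.trans_lt ht.1
      refine ⟨(homeomorphUnitSphereProd E).symm (⟨θ, hΘ hθ⟩, ⟨t, ht0⟩), ?_, rfl⟩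
      rw [mem_preimage, Homeomorph.apply_symm_apply]
      exact ⟨hθ, ht⟩
  rw [← hsector, ← (MeasurableEmbedding.subtype_coe
    (measurableSet_singleton (0 : E)).compl).comap_apply,
    hpolar.measure_preimage_emb (homeomorphUnitSphereProd E).measurableEmbedding,
    Measure.prod_prod, hΘ', hI, mul_comm]

end Sector

/-! ### Radial shadows in a shell -/

/-- The ratio of the volume of the shell `r₁ < ‖x‖ < r₂` in dimension `n + 1` to the area of its
outer boundary. It is the largest flux density of the radial vector field whose divergence is the
indicator function of the shell. -/
noncomputable def shellFluxConstant (n : ℕ) (r₁ r₂ : ℝ) : ℝ :=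
  (r₂ ^ (n + 1) - r₁ ^ (n + 1)) / ((n + 1) * r₂ ^ n)

section ShellFluxConstant

variable {n : ℕ} {r₁ r₂ : ℝ}

theorem shellFluxConstant_mul_pow (hr₂ : r₂ ≠ 0) :
    shellFluxConstant n r₁ r₂ * r₂ ^ n = (r₂ ^ (n + 1) - r₁ ^ (n + 1)) / (n + 1) := by
  rw [shellFluxConstant]
  field_simp

theorem shellFluxConstant_pos (hr₁ : 0 ≤ r₁) (hr₁₂ : r₁ < r₂) : 0 < shellFluxConstant n r₁ r₂ := by
  have hr₂ : 0 < r₂ := hr₁.trans_lt hr₁₂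
  have hpow : r₁ ^ (n + 1) < r₂ ^ (n + 1) := pow_lt_pow_left₀ hr₁₂ hr₁ (by simp)
  exact div_pos (sub_pos.2 hpow) (by positivity)

theorem min_pow_sub_pow_div_le_shellFluxConstant_mul_pow (hr₁ : 0 ≤ r₁) (hr₁₂ : r₁ < r₂) {s : ℝ}
    (hs : 0 ≤ s) :
    (min r₂ s ^ (n + 1) - r₁ ^ (n + 1)) / (n + 1) ≤ shellFluxConstant n r₁ r₂ * s ^ n := by
  have hr₂ : 0 < r₂ := hr₁.trans_lt hr₁₂
  rcases le_total r₂ s with h | h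
  · rw [min_eq_left h, ← shellFluxConstant_mul_pow hr₂.ne']
    exact mul_le_mul_of_nonneg_left (pow_le_pow_left₀ hr₂.le h n)
      (shellFluxConstant_pos hr₁ hr₁₂).le
  · have hpow : s ^ n ≤ r₂ ^ n := pow_le_pow_left₀ hs h n
    have hcross : (s ^ (n + 1) - r₁ ^ (n + 1)) * r₂ ^ n ≤ (r₂ ^ (n + 1) - r₁ ^ (n + 1)) * s ^ n :=
      calc (s ^ (n + 1) - r₁ ^ (n + 1)) * r₂ ^ n
          = s * (s ^ n * r₂ ^ n) - r₁ ^ (n + 1) * r₂ ^ n := by ring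
        _ ≤ r₂ * (s ^ n * r₂ ^ n) - r₁ ^ (n + 1) * s ^ n := by gcongr
        _ = (r₂ ^ (n + 1) - r₁ ^ (n + 1)) * s ^ n := by ring
    rw [min_eq_right h, shellFluxConstant, div_mul_eq_mul_div,
      div_le_div_iff₀ (by positivity) (by positivity)]
    calc (s ^ (n + 1) - r₁ ^ (n + 1)) * ((n + 1) * r₂ ^ n)
        = (n + 1) * ((s ^ (n + 1) - r₁ ^ (n + 1)) * r₂ ^ n) := by ring
      _ ≤ (n + 1) * ((r₂ ^ (n + 1) - r₁ ^ (n + 1)) * s ^ n) := by gcongr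
      _ = (r₂ ^ (n + 1) - r₁ ^ (n + 1)) * s ^ n * (n + 1) := by ring

end ShellFluxConstant

theorem shell_eq_preimage_norm (N : ℕ) (r₁ r₂ : ℝ) : shell N r₁ r₂ = norm ⁻¹' Ioo r₁ r₂ := by
  ext x
  simp [shell, and_comm]

theorem volume_preimage_norm_Ioo {E : Type*} [NormedAddCommGroup E] [InnerProductSpace ℝ E]
    [FiniteDimensional ℝ E] [MeasurableSpace E] [BorelSpace E] {n : ℕ}
    (hn : Module.finrank ℝ E = n + 1) {r₁ r₂ : ℝ} (hr₁ : 0 ≤ r₁) (hr₂ : 0 < r₂) :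
    volume (norm ⁻¹' Ioo r₁ r₂ : Set E) =
      ENNReal.ofReal (shellFluxConstant n r₁ r₂) * μHE[n] (Metric.sphere (0 : E) r₂) := by
  rw [← Ioo_smul_sphere_one_eq hr₁, volume_Ioo_smul hn subset_rfl hr₁ hr₂.le,
    ← shellFluxConstant_mul_pow hr₂.ne', ENNReal.ofReal_mul' (by positivity), mul_assoc,
    euclideanHausdorffMeasure_sphere hn hr₂, euclideanHausdorffMeasure_sphere hn one_pos, one_pow,
    ENNReal.ofReal_one, one_mul]

section Shadow

open scoped Pointwise

variable {E : Type*} [NormedAddCommGroup E]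

section NormedSpace

variable [NormedSpace ℝ E]

/-- The outer measure of the radial shadow of a set, restricted to `S`. The shadow of `A` consists
of the points of the segments joining the origin to the points of `A`. -/
noncomputable def shadowOuterMeasure [MeasurableSpace E] (μ : Measure E) (S : Set E) :
    OuterMeasure E where
  measureOf A := μ (S ∩ Icc (0 : ℝ) 1 • A)
  empty := by simp
  mono h := measure_mono (inter_subset_inter_right S (smul_subset_smul_left h))
  iUnion_nat A _ := by
    rw [smul_iUnion, inter_iUnion]
    exact measure_iUnion_le _

theorem shadowOuterMeasure_apply [MeasurableSpace E] (μ : Measure E) (S A : Set E) :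
    shadowOuterMeasure μ S A = μ (S ∩ Icc (0 : ℝ) 1 • A) :=
  rfl

theorem sdiff_zero_subset_Icc_smul_frontier {U : Set E} (hU : Bornology.IsBounded U) :
    U \ {0} ⊆ Icc (0 : ℝ) 1 • (frontier U \ {0}) := by
  rintro x ⟨hxU, hx : x ≠ 0⟩
  have hxn : 0 < ‖x‖ := norm_pos_iff.2 hx
  have : PreconnectedSpace (Ici (1 : ℝ)) := Subtype.preconnectedSpace isPreconnected_Ici
  let ray : Ici (1 : ℝ) → E := fun t => (t : ℝ) • x
  have hray : Continuous ray := by fun_prop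
  have hmem : (ray ⁻¹' U).Nonempty := ⟨⟨1, self_mem_Ici⟩, by simpa [ray] using hxU⟩
  have hleave : ray ⁻¹' U ≠ univ := fun huniv => by
    obtain ⟨M, hM⟩ := hU.exists_norm_le
    have hM' := hM _ (huniv.ge (mem_univ ⟨max 1 ((M + 1) / ‖x‖), mem_Ici.2 (le_max_left _ _)⟩))
    have hge : M + 1 ≤ max 1 ((M + 1) / ‖x‖) * ‖x‖ := (div_le_iff₀ hxn).1 (le_max_right _ _)
    rw [norm_smul, Real.norm_of_nonneg (zero_le_one.trans (le_max_left _ _))] at hM'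
    linarith
  obtain ⟨⟨t, ht : 1 ≤ t⟩, htU⟩ := nonempty_frontier_iff.2 ⟨hmem, hleave⟩
  have ht0 : t ≠ 0 := (one_pos.trans_le ht).ne'
  exact ⟨t⁻¹, ⟨by positivity, inv_le_one_of_one_le₀ ht⟩, t • x,
    ⟨hray.frontier_preimage_subset U htU, smul_ne_zero ht0 hx⟩, inv_smul_smul₀ ht0 x⟩

theorem preimage_norm_Ioo_inter_Icc_smul_subset {A : Set E} {b : ℝ} (hA : ∀ y ∈ A, ‖y‖ < b) {r₁ : ℝ}
    (hr₁ : 0 ≤ r₁) (r₂ : ℝ) :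
    norm ⁻¹' Ioo r₁ r₂ ∩ Icc (0 : ℝ) 1 • A ⊆
      Ioo r₁ (min r₂ b) • (fun y : E => ‖y‖⁻¹ • y) '' A := by
  rintro _ ⟨hx, t, ht, y, hy, rfl⟩
  have hy0 : ‖y‖ ≠ 0 := fun h => by
    simpa [norm_smul, h] using hr₁.trans_lt hx.1
  have hnorm : ‖t • y‖ = t * ‖y‖ := by rw [norm_smul, Real.norm_of_nonneg ht.1]
  refine ⟨t * ‖y‖, ⟨hnorm ▸ hx.1, lt_min (hnorm ▸ hx.2) ?_⟩, _, mem_image_of_mem _ hy, ?_⟩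
  · exact (mul_le_of_le_one_left (norm_nonneg y) ht.2).trans_lt (hA y hy)
  · simp only [smul_smul, mul_assoc, mul_inv_cancel₀ hy0, mul_one]

end NormedSpace

variable [InnerProductSpace ℝ E] [FiniteDimensional ℝ E] [MeasurableSpace E] [BorelSpace E] {n : ℕ}

theorem shadowOuterMeasure_shell_le_of_subset_preimage_norm_Ioo
    (hn : Module.finrank ℝ E = n + 1) {r₁ r₂ : ℝ} (hr₁ : 0 ≤ r₁) (hr₁₂ : r₁ < r₂) {a b : NNReal}
    (ha : 0 < a) {A : Set E} (hA : A ⊆ norm ⁻¹' Ioo (a : ℝ) b) :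
    shadowOuterMeasure volume (norm ⁻¹' Ioo r₁ r₂) A ≤
      ENNReal.ofReal (shellFluxConstant n r₁ r₂) * ((b / a : NNReal) ^ n * μHE[n] A) := by
  set Θ : Set E := (fun y : E => ‖y‖⁻¹ • y) '' A
  have hΘ : Θ ⊆ Metric.sphere 0 1 := image_subset_iff.2 fun y hy => by
    have hy0 : ‖y‖ ≠ 0 := (a.2.trans_lt (hA hy).1).ne'
    simp [norm_smul, hy0]
  have hLip : LipschitzOnWith a⁻¹ (fun y : E => ‖y‖⁻¹ • y) A :=
    (lipschitzOnWith_inv_norm_smul ha).mono fun y hy => (hA hy).1.le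
  rw [shadowOuterMeasure_apply]
  calc volume (norm ⁻¹' Ioo r₁ r₂ ∩ Icc (0 : ℝ) 1 • A)
      ≤ volume (Ioo r₁ (min r₂ b) • Θ) :=
        measure_mono (preimage_norm_Ioo_inter_Icc_smul_subset (fun y hy => (hA hy).2) hr₁ r₂)
    _ = ENNReal.ofReal ((min r₂ b ^ (n + 1) - r₁ ^ (n + 1)) / (n + 1)) * μHE[n] Θ :=
        volume_Ioo_smul hn hΘ hr₁ (le_min (hr₁.trans hr₁₂.le) b.2)
    _ ≤ ENNReal.ofReal (shellFluxConstant n r₁ r₂ * b ^ n) *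
          ((a⁻¹ : NNReal) ^ n * μHE[n] A) := by
        gcongr
        · exact min_pow_sub_pow_div_le_shellFluxConstant_mul_pow hr₁ hr₁₂ b.2
        · exact euclideanHausdorffMeasure_image_le_of_lipschitzOnWith hLip n
    _ = ENNReal.ofReal (shellFluxConstant n r₁ r₂) * ((b / a : NNReal) ^ n * μHE[n] A) := by
        rw [ENNReal.ofReal_mul' (by positivity), ENNReal.ofReal_pow b.coe_nonneg,
          ENNReal.ofReal_coe_nnreal, mul_assoc, ← mul_assoc ((b : ℝ≥0∞) ^ n), ← mul_pow,
          ← ENNReal.coe_mul, div_eq_mul_inv]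

theorem shadowOuterMeasure_shell_le_mul_euclideanHausdorffMeasure
    (hn : Module.finrank ℝ E = n + 1) {r₁ r₂ : ℝ} (hr₁ : 0 ≤ r₁) (hr₁₂ : r₁ < r₂) {A : Set E}
    (hA : MeasurableSet A) (hA0 : (0 : E) ∉ A) :
    shadowOuterMeasure volume (norm ⁻¹' Ioo r₁ r₂) A ≤
      ENNReal.ofReal (shellFluxConstant n r₁ r₂) * μHE[n] A := by
  refine le_of_forall_one_lt_le_pow_mul (2 * n) fun c hc => ?_
  rw [← mul_assoc]
  refine outerMeasure_le_mul_of_locally_le hA fun y hy =>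
    ⟨norm ⁻¹' Ioo ((‖y‖₊ / c : NNReal) : ℝ) (c * ‖y‖₊ : NNReal), ?_, fun B hB _ => ?_⟩
  all_goals
    have hy0 : 0 < ‖y‖₊ := nnnorm_pos.2 fun h => hA0 (h ▸ hy)
  · refine continuous_norm.continuousAt.preimage_mem_nhds (Ioo_mem_nhds ?_ ?_)
    · rw [← coe_nnnorm, NNReal.coe_lt_coe]
      exact div_lt_self hy0 hc
    · rw [← coe_nnnorm, NNReal.coe_lt_coe]
      exact lt_mul_of_one_lt_left hy0 hc
  · have hratio : c * ‖y‖₊ / (‖y‖₊ / c) = c ^ 2 := by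
      have hc0 : c ≠ 0 := (one_pos.trans hc).ne'
      field_simp
    refine (shadowOuterMeasure_shell_le_of_subset_preimage_norm_Ioo hn hr₁ hr₁₂
      (div_pos hy0 (one_pos.trans hc)) hB).trans_eq ?_
    rw [hratio, ENNReal.coe_pow, ← pow_mul]
    ring

theorem volume_inter_shell_le_mul_euclideanHausdorffMeasure_frontier
    (hn : Module.finrank ℝ E = n + 1) {r₁ r₂ : ℝ} (hr₁ : 0 ≤ r₁) (hr₁₂ : r₁ < r₂) {U : Set E}
    (hU : Bornology.IsBounded U) :
    volume (U ∩ norm ⁻¹' Ioo r₁ r₂) ≤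
      ENNReal.ofReal (shellFluxConstant n r₁ r₂) * μHE[n] (frontier U) := by
  have hshadow : U ∩ norm ⁻¹' Ioo r₁ r₂ ⊆
      norm ⁻¹' Ioo r₁ r₂ ∩ Icc (0 : ℝ) 1 • (frontier U \ {0}) := fun x hx =>
    ⟨hx.2, sdiff_zero_subset_Icc_smul_frontier hU
      ⟨hx.1, norm_pos_iff.1 (hr₁.trans_lt hx.2.1)⟩⟩
  calc volume (U ∩ norm ⁻¹' Ioo r₁ r₂)
      ≤ shadowOuterMeasure volume (norm ⁻¹' Ioo r₁ r₂) (frontier U \ {0}) :=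
        (measure_mono hshadow).trans_eq (shadowOuterMeasure_apply _ _ _).symm
    _ ≤ ENNReal.ofReal (shellFluxConstant n r₁ r₂) * μHE[n] (frontier U \ {0}) :=
        shadowOuterMeasure_shell_le_mul_euclideanHausdorffMeasure hn hr₁ hr₁₂
          (isClosed_frontier.measurableSet.diff (measurableSet_singleton 0)) fun h => h.2 rfl
    _ ≤ ENNReal.ofReal (shellFluxConstant n r₁ r₂) * μHE[n] (frontier U) := by
        gcongr
        exact sdiff_subset

end Shadow

/-! ### Integration along rays -/

theorem lintegral_mul_setLIntegral_Ioi {α : Type*} [LinearOrder α] [TopologicalSpace α]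
    [OrderClosedTopology α] [SecondCountableTopology α] [MeasurableSpace α] [BorelSpace α]
    {μ ν : Measure α} [SFinite μ] [SFinite ν] {g m : α → ℝ≥0∞} (hg : Measurable g)
    (hm : Measurable m) :
    ∫⁻ r, g r * ∫⁻ s in Ioi r, m s ∂ν ∂μ = ∫⁻ s, (∫⁻ r in Iio s, g r ∂μ) * m s ∂ν := by
  let F : α × α → ℝ≥0∞ := {p | p.1 < p.2}.indicator fun p => g p.1 * m p.2
  have hF : Measurable F :=
    Measurable.indicator (by fun_prop) (measurableSet_lt measurable_fst measurable_snd)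
  calc ∫⁻ r, g r * ∫⁻ s in Ioi r, m s ∂ν ∂μ = ∫⁻ r, ∫⁻ s, F (r, s) ∂ν ∂μ :=
        lintegral_congr fun r => by
          rw [← lintegral_const_mul _ hm, ← lintegral_indicator measurableSet_Ioi]
          rfl
    _ = ∫⁻ s, ∫⁻ r, F (r, s) ∂μ ∂ν := lintegral_lintegral_swap hF.aemeasurable
    _ = ∫⁻ s, (∫⁻ r in Iio s, g r ∂μ) * m s ∂ν :=
        lintegral_congr fun s => by
          rw [← lintegral_mul_const _ hg, ← lintegral_indicator measurableSet_Iio]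
          rfl

theorem lintegral_Ioo_pow_mul_setLIntegral_Ioi_le (n : ℕ) {r₁ r₂ : ℝ} (hr₁ : 0 ≤ r₁)
    (hr₁₂ : r₁ < r₂) {m : ℝ → ℝ≥0∞} (hm : Measurable m) :
    ∫⁻ r in Ioo r₁ r₂, ENNReal.ofReal (r ^ n) * ∫⁻ s in Ioi r, m s ≤
      ENNReal.ofReal (shellFluxConstant n r₁ r₂) *
        ∫⁻ s in Ioi (0 : ℝ), ENNReal.ofReal (s ^ n) * m s := by
  have hweight : ∀ s : ℝ, 0 < s → ∫⁻ r in Iio s, ENNReal.ofReal (r ^ n)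
      ∂(volume.restrict (Ioo r₁ r₂)) ≤
        ENNReal.ofReal (shellFluxConstant n r₁ r₂) * ENNReal.ofReal (s ^ n) := fun s hs => by
    rw [Measure.restrict_restrict measurableSet_Iio, inter_comm, Ioo_inter_Iio,
      lintegral_Ioo_pow n hr₁ (le_min (hr₁.trans hr₁₂.le) hs.le),
      ← ENNReal.ofReal_mul' (by positivity)]
    exact ENNReal.ofReal_le_ofReal
      (min_pow_sub_pow_div_le_shellFluxConstant_mul_pow hr₁ hr₁₂ hs.le)
  calc ∫⁻ r in Ioo r₁ r₂, ENNReal.ofReal (r ^ n) * ∫⁻ s in Ioi r, m s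
      = ∫⁻ r in Ioo r₁ r₂, ENNReal.ofReal (r ^ n) *
          ∫⁻ s in Ioi r, m s ∂(volume.restrict (Ioi 0)) :=
        setLIntegral_congr_fun measurableSet_Ioo fun r hr => by
          rw [Measure.restrict_restrict measurableSet_Ioi,
            inter_eq_left.2 (Ioi_subset_Ioi (hr₁.trans hr.1.le))]
    _ = ∫⁻ s in Ioi (0 : ℝ),
          (∫⁻ r in Iio s, ENNReal.ofReal (r ^ n) ∂(volume.restrict (Ioo r₁ r₂))) * m s :=
        lintegral_mul_setLIntegral_Ioi (by fun_prop) hm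
    _ ≤ ∫⁻ s in Ioi (0 : ℝ), ENNReal.ofReal (shellFluxConstant n r₁ r₂) *
          (ENNReal.ofReal (s ^ n) * m s) :=
        setLIntegral_mono (by fun_prop) fun s hs => by
          rw [← mul_assoc]
          gcongr
          exact hweight s hs
    _ = ENNReal.ofReal (shellFluxConstant n r₁ r₂) *
          ∫⁻ s in Ioi (0 : ℝ), ENNReal.ofReal (s ^ n) * m s :=
        lintegral_const_mul _ (by fun_prop)

section Polar

variable {E : Type*} [NormedAddCommGroup E] [NormedSpace ℝ E] [FiniteDimensional ℝ E]
  [MeasurableSpace E] [BorelSpace E] (μ : Measure E) [μ.IsAddHaarMeasure] {n : ℕ}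

theorem lintegral_polar (hn : Module.finrank ℝ E = n + 1) {f : E → ℝ≥0∞} (hf : Measurable f) :
    ∫⁻ x, f x ∂μ = ∫⁻ θ : Metric.sphere (0 : E) 1,
      ∫⁻ r in Ioi (0 : ℝ), ENNReal.ofReal (r ^ n) * f (r • (θ : E)) ∂volume ∂μ.toSphere := by
  have : Nontrivial E := Module.nontrivial_of_finrank_pos (R := ℝ) (by omega)
  have hpolar := μ.measurePreserving_homeomorphUnitSphereProd
  rw [hn, Nat.add_sub_cancel] at hpolar
  have hF : Measurable fun p : Metric.sphere (0 : E) 1 × Ioi (0 : ℝ) =>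
      f ((p.2 : ℝ) • (p.1 : E)) := hf.comp (by fun_prop)
  calc ∫⁻ x, f x ∂μ = ∫⁻ x : ({(0)}ᶜ : Set E), f x ∂(μ.comap (↑)) := by
        rw [lintegral_subtype_comap (measurableSet_singleton _).compl, restrict_compl_singleton]
    _ = ∫⁻ p, f ((p.2 : ℝ) • (p.1 : E)) ∂(μ.toSphere.prod (.volumeIoiPow n)) := by
        rw [← hpolar.lintegral_comp hF]
        refine lintegral_congr fun x => congrArg f ?_
        exact (congrArg Subtype.val ((homeomorphUnitSphereProd E).symm_apply_apply x)).symm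
    _ = ∫⁻ θ, ∫⁻ r : Ioi (0 : ℝ), f ((r : ℝ) • (θ : E)) ∂(.volumeIoiPow n) ∂μ.toSphere :=
        lintegral_prod _ hF.aemeasurable
    _ = _ := lintegral_congr fun θ => by
        have hray : Measurable fun r : ℝ => f (r • (θ : E)) := hf.comp (by fun_prop)
        refine (lintegral_withDensity_eq_lintegral_mul _ (by fun_prop)
          (hray.comp measurable_subtype_coe)).trans ?_
        exact lintegral_subtype_comap measurableSet_Ioi
          fun r : ℝ => ENNReal.ofReal (r ^ n) * f (r • (θ : E))

theorem setLIntegral_preimage_norm_polar (hn : Module.finrank ℝ E = n + 1) {f : E → ℝ≥0∞}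
    (hf : Measurable f) {J : Set ℝ} (hJ : MeasurableSet J) (hJ0 : J ⊆ Ioi 0) :
    ∫⁻ x in norm ⁻¹' J, f x ∂μ = ∫⁻ θ : Metric.sphere (0 : E) 1,
      ∫⁻ r in J, ENNReal.ofReal (r ^ n) * f (r • (θ : E)) ∂volume ∂μ.toSphere := by
  have hnorm : MeasurableSet (norm ⁻¹' J : Set E) := measurable_norm hJ
  rw [← lintegral_indicator hnorm, lintegral_polar μ hn (hf.indicator hnorm)]
  refine lintegral_congr fun θ => ?_
  have hJ' : volume.restrict J = (volume.restrict (Ioi 0)).restrict J := by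
    rw [Measure.restrict_restrict hJ, inter_eq_left.2 hJ0]
  rw [hJ', ← lintegral_indicator hJ]
  refine setLIntegral_congr_fun measurableSet_Ioi fun r hr => ?_
  have hrθ : ‖r • (θ : E)‖ = r := by
    rw [norm_smul, norm_eq_of_mem_sphere θ, mul_one, Real.norm_of_nonneg (mem_Ioi.1 hr).le]
  by_cases hrJ : r ∈ J
  · rw [indicator_of_mem hrJ, indicator_of_mem (by simpa only [mem_preimage, hrθ] using hrJ)]
  · rw [indicator_of_notMem hrJ, indicator_of_notMem (by simpa only [mem_preimage, hrθ] using hrJ),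
      mul_zero]

end Polar

section Gradient

variable {E : Type*} [NormedAddCommGroup E] [InnerProductSpace ℝ E] [CompleteSpace E] {φ : E → ℝ}

theorem norm_gradient_eq_norm_fderiv (φ : E → ℝ) (x : E) : ‖gradient φ x‖ = ‖fderiv ℝ φ x‖ := by
  rw [← toDual_gradient, LinearIsometryEquiv.norm_map]

theorem continuous_gradient_of_contDiff (hφ : ContDiff ℝ 1 φ) : Continuous (gradient φ) :=
  (LinearIsometryEquiv.continuous _).comp (hφ.continuous_fderiv one_ne_zero)

theorem support_gradient_subset_tsupport (φ : E → ℝ) :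
    Function.support (gradient φ) ⊆ tsupport φ := fun x hx =>
  support_fderiv_subset ℝ fun h => hx <| by
    rw [← norm_eq_zero, norm_gradient_eq_norm_fderiv, h, norm_zero]

theorem enorm_le_lintegral_enorm_gradient_ray (hφ : ContDiff ℝ 1 φ) (hc : HasCompactSupport φ)
    {θ : E} (hθ : ‖θ‖ = 1) (r : ℝ) :
    ‖φ (r • θ)‖ₑ ≤ ∫⁻ s in Ioi r, ‖gradient φ (s • θ)‖ₑ := by
  have hiso : Isometry fun s : ℝ => s • θ := Isometry.of_dist_eq fun s t => by
    rw [dist_eq_norm, ← sub_smul, norm_smul, hθ, mul_one, dist_eq_norm]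
  have hray : ContDiff ℝ 1 fun s : ℝ => φ (s • θ) := hφ.comp (by fun_prop)
  have hderiv : ∀ s : ℝ, deriv (fun s : ℝ => φ (s • θ)) s = fderiv ℝ φ (s • θ) θ := fun s =>
    ((hφ.differentiable one_ne_zero _).hasFDerivAt.comp_hasDerivAt s
      (by simpa using (hasDerivAt_id s).smul_const θ)).deriv
  rw [← enorm_neg, ← HasCompactSupport.integral_Ioi_deriv_eq hray
    (hc.comp_isClosedEmbedding hiso.isClosedEmbedding) r]
  refine (enorm_integral_le_lintegral_enorm _).trans (lintegral_mono fun s => ?_)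
  rw [enorm_le_iff_norm_le, hderiv, norm_gradient_eq_norm_fderiv]
  simpa [hθ] using (fderiv ℝ φ (s • θ)).le_opNorm θ

end Gradient

theorem setLIntegral_shell_enorm_le {E : Type*} [NormedAddCommGroup E] [InnerProductSpace ℝ E]
    [FiniteDimensional ℝ E] [MeasurableSpace E] [BorelSpace E] {n : ℕ}
    (hn : Module.finrank ℝ E = n + 1) {r₁ r₂ : ℝ} (hr₁ : 0 ≤ r₁) (hr₁₂ : r₁ < r₂) {φ : E → ℝ}
    (hφ : ContDiff ℝ 1 φ) (hc : HasCompactSupport φ) :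
    ∫⁻ x in norm ⁻¹' Ioo r₁ r₂, ‖φ x‖ₑ ≤
      ENNReal.ofReal (shellFluxConstant n r₁ r₂) * ∫⁻ x, ‖gradient φ x‖ₑ := by
  have hφm : Measurable fun x => ‖φ x‖ₑ := hφ.continuous.enorm.measurable
  have hgm : Measurable fun x => ‖gradient φ x‖ₑ :=
    (continuous_gradient_of_contDiff hφ).enorm.measurable
  have hpolar : Measurable fun p : Metric.sphere (0 : E) 1 × ℝ =>
      ENNReal.ofReal (p.2 ^ n) * ‖gradient φ (p.2 • (p.1 : E))‖ₑ :=
    Measurable.mul (by fun_prop) (hgm.comp (by fun_prop))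
  rw [setLIntegral_preimage_norm_polar volume hn hφm measurableSet_Ioo fun r hr =>
      hr₁.trans_lt hr.1,
    lintegral_polar volume hn hgm, ← lintegral_const_mul _ hpolar.lintegral_prod_right']
  refine lintegral_mono fun θ => ?_
  calc ∫⁻ r in Ioo r₁ r₂, ENNReal.ofReal (r ^ n) * ‖φ (r • (θ : E))‖ₑ
      ≤ ∫⁻ r in Ioo r₁ r₂, ENNReal.ofReal (r ^ n) *
          ∫⁻ s in Ioi r, ‖gradient φ (s • (θ : E))‖ₑ := by
        gcongr with r
        exact enorm_le_lintegral_enorm_gradient_ray hφ hc (norm_eq_of_mem_sphere θ) r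
    _ ≤ ENNReal.ofReal (shellFluxConstant n r₁ r₂) *
          ∫⁻ s in Ioi (0 : ℝ), ENNReal.ofReal (s ^ n) * ‖gradient φ (s • (θ : E))‖ₑ :=
        lintegral_Ioo_pow_mul_setLIntegral_Ioi_le n hr₁ hr₁₂ (hgm.comp (by fun_prop))

/-! ### Radial cutoffs and capacity -/

theorem lintegral_Ioi_enorm_deriv_of_antitoneOn {g : ℝ → ℝ} {a : ℝ} (hg : ContDiff ℝ 1 g)
    (hc : HasCompactSupport g) (hanti : AntitoneOn g (Ioi a)) :
    ∫⁻ r in Ioi a, ‖deriv g r‖ₑ = ENNReal.ofReal (g a) := by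
  have hint : Integrable (deriv g) :=
    (hg.continuous_deriv le_rfl).integrable_of_hasCompactSupport hc.deriv
  have hneg : ∀ r ∈ Ioi a, 0 ≤ -deriv g r := fun r hr => by
    rw [← derivWithin_of_isOpen isOpen_Ioi hr]
    exact neg_nonneg.2 hanti.derivWithin_nonpos
  calc ∫⁻ r in Ioi a, ‖deriv g r‖ₑ = ∫⁻ r in Ioi a, ENNReal.ofReal (-deriv g r) :=
        setLIntegral_congr_fun measurableSet_Ioi fun r hr => by
          rw [← enorm_neg, Real.enorm_of_nonneg (hneg r hr)]
    _ = ENNReal.ofReal (∫ r in Ioi a, -deriv g r) :=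
        (ofReal_integral_eq_lintegral_ofReal hint.neg.integrableOn
          (ae_restrict_of_forall_mem measurableSet_Ioi hneg)).symm
    _ = ENNReal.ofReal (g a) := by
        rw [integral_neg, hc.integral_Ioi_deriv_eq hg, neg_neg]

section Radial

variable {E : Type*} [NormedAddCommGroup E] {f : ℝ → ℝ} {b : ℝ}

theorem tsupport_comp_norm_sq_subset_closedBall (hb : 0 ≤ b) (hf : ∀ t, b ^ 2 ≤ t → f t = 0) :
    tsupport (fun x : E => f (‖x‖ ^ 2)) ⊆ Metric.closedBall 0 b := by
  refine closure_minimal (fun x hx => ?_) Metric.isClosed_closedBall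
  rw [mem_closedBall_zero_iff]
  by_contra! hbx
  exact hx (hf _ (by gcongr))

theorem hasCompactSupport_comp_norm_sq [ProperSpace E] (hb : 0 ≤ b)
    (hf : ∀ t, b ^ 2 ≤ t → f t = 0) : HasCompactSupport fun x : E => f (‖x‖ ^ 2) :=
  (isCompact_closedBall 0 b).of_isClosed_subset (isClosed_tsupport _)
    (tsupport_comp_norm_sq_subset_closedBall hb hf)

variable [InnerProductSpace ℝ E]

theorem norm_gradient_comp_norm_sq [CompleteSpace E] (hf : Differentiable ℝ f) {θ : E}
    (hθ : ‖θ‖ = 1) (r : ℝ) :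
    ‖gradient (fun x : E => f (‖x‖ ^ 2)) (r • θ)‖ = ‖deriv (fun s : ℝ => f (s ^ 2)) r‖ := by
  have hradial : HasFDerivAt (fun x : E => f (‖x‖ ^ 2))
      (deriv f (‖r • θ‖ ^ 2) • 2 • innerSL ℝ (r • θ)) (r • θ) :=
    (hf _).hasDerivAt.comp_hasFDerivAt (r • θ) (hasStrictFDerivAt_norm_sq _).hasFDerivAt
  have hprofile : HasDerivAt (fun s : ℝ => f (s ^ 2)) (deriv f (r ^ 2) * (2 * r)) r :=
    HasDerivAt.comp (h₂ := f) r (hf (r ^ 2)).hasDerivAt (by simpa using hasDerivAt_pow 2 r)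
  rw [norm_gradient_eq_norm_fderiv, hradial.fderiv, hprofile.deriv, ← Nat.cast_smul_eq_nsmul ℝ,
    norm_smul (deriv f _), norm_smul (_ : ℝ) (innerSL ℝ _), innerSL_apply_norm]
  simp [norm_smul, hθ]

theorem lintegral_enorm_gradient_comp_norm_sq_le [FiniteDimensional ℝ E] [MeasurableSpace E]
    [BorelSpace E] {n : ℕ} (hn : Module.finrank ℝ E = n + 1) (hf : ContDiff ℝ 1 f)
    (hanti : Antitone f) (hb : 0 ≤ b) (hfb : ∀ t, b ^ 2 ≤ t → f t = 0) :
    ∫⁻ x : E, ‖gradient (fun x => f (‖x‖ ^ 2)) x‖ₑ ≤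
      ENNReal.ofReal (b ^ n) * ENNReal.ofReal (f 0) * (volume : Measure E).toSphere univ := by
  have hprofile : ContDiff ℝ 1 fun s : ℝ => f (s ^ 2) := hf.comp (by fun_prop)
  have hsupp : HasCompactSupport fun s : ℝ => f (s ^ 2) := by
    simpa only [Real.norm_eq_abs, sq_abs] using hasCompactSupport_comp_norm_sq (E := ℝ) hb hfb
  have hprofile_anti : AntitoneOn (fun s : ℝ => f (s ^ 2)) (Ioi 0) := fun s hs t _ hst =>
    hanti (pow_le_pow_left₀ (mem_Ioi.1 hs).le hst 2)
  have hderiv : ∀ s, b < s → deriv (fun s : ℝ => f (s ^ 2)) s = 0 := fun s hs => by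
    have hzero : (fun s : ℝ => f (s ^ 2)) =ᶠ[nhds s] fun _ => 0 := by
      filter_upwards [lt_mem_nhds hs] with t ht using hfb _ (by gcongr)
    rw [hzero.deriv_eq, deriv_const]
  have hradial : ContDiff ℝ 1 fun x : E => f (‖x‖ ^ 2) := hf.comp (contDiff_norm_sq ℝ)
  rw [lintegral_polar volume hn (continuous_gradient_of_contDiff hradial).enorm.measurable,
    ← lintegral_const]
  refine lintegral_mono fun θ => ?_
  calc ∫⁻ s in Ioi (0 : ℝ), ENNReal.ofReal (s ^ n) *
        ‖gradient (fun x : E => f (‖x‖ ^ 2)) (s • (θ : E))‖ₑ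
      ≤ ∫⁻ s in Ioi (0 : ℝ), ENNReal.ofReal (b ^ n) * ‖deriv (fun s : ℝ => f (s ^ 2)) s‖ₑ := by
        refine setLIntegral_mono (by fun_prop) fun s hs => ?_
        rw [enorm_eq_iff_norm_eq.2 (norm_gradient_comp_norm_sq
          (hf.differentiable one_ne_zero) (norm_eq_of_mem_sphere θ) s)]
        obtain hsb | hbs := le_or_gt s b
        · have := (mem_Ioi.1 hs).le
          gcongr
        · simp [hderiv s hbs]
    _ = ENNReal.ofReal (b ^ n) * ENNReal.ofReal (f 0) := by
        rw [lintegral_const_mul _ (by fun_prop),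
          lintegral_Ioi_enorm_deriv_of_antitoneOn hprofile hsupp hprofile_anti,
          zero_pow two_ne_zero]

end Radial

section Cutoff

/-- The smooth radial profile, as a function of the squared radius, that decreases from `1` at
radius `a` to `0` at radius `b`. The squared radius makes `x ↦ cutoffProfile a b (‖x‖ ^ 2)` smooth
at the origin as well. -/
noncomputable def cutoffProfile (a b t : ℝ) : ℝ :=
  Real.smoothTransition ((b ^ 2 - t) / (b ^ 2 - a ^ 2))

theorem contDiff_cutoffProfile (a b : ℝ) : ContDiff ℝ ∞ (cutoffProfile a b) :=
  Real.smoothTransition.contDiff.comp (by fun_prop)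

variable {a b : ℝ}

theorem antitone_cutoffProfile (hab : a ^ 2 ≤ b ^ 2) : Antitone (cutoffProfile a b) :=
  fun _ _ hst => Real.smoothTransition.monotone <|
    div_le_div_of_nonneg_right (sub_le_sub_left hst _) (sub_nonneg.2 hab)

theorem cutoffProfile_eq_one (hab : a ^ 2 < b ^ 2) {t : ℝ} (ht : t ≤ a ^ 2) :
    cutoffProfile a b t = 1 :=
  Real.smoothTransition.one_of_one_le <|
    (one_le_div (sub_pos.2 hab)).2 (sub_le_sub_left ht _)

theorem cutoffProfile_eq_zero (hab : a ^ 2 ≤ b ^ 2) {t : ℝ} (ht : b ^ 2 ≤ t) :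
    cutoffProfile a b t = 0 :=
  Real.smoothTransition.zero_of_nonpos <|
    div_nonpos_of_nonpos_of_nonneg (sub_nonpos.2 ht) (sub_nonneg.2 hab)

/-- The radial test function on `Ω` that equals `1` on the closed ball of radius `a` and vanishes
outside the ball of radius `b`. -/
noncomputable def radialCutoff {N : ℕ} {Ω : Opens (EuclideanSpace ℝ (Fin N))} (ha : 0 ≤ a)
    (hab : a < b) (hbΩ : Metric.closedBall (0 : EuclideanSpace ℝ (Fin N)) b ⊆ Ω) :
    𝓓(Ω, ℝ) where
  toFun x := cutoffProfile a b (‖x‖ ^ 2)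
  contDiff' := (contDiff_cutoffProfile a b).comp (contDiff_norm_sq ℝ)
  hasCompactSupport' := hasCompactSupport_comp_norm_sq (ha.trans hab.le) fun _ =>
    cutoffProfile_eq_zero (by gcongr)
  tsupport_subset' := (tsupport_comp_norm_sq_subset_closedBall (ha.trans hab.le) fun _ =>
    cutoffProfile_eq_zero (by gcongr)).trans hbΩ

variable {n : ℕ} {Ω : Opens (EuclideanSpace ℝ (Fin (n + 1)))}

theorem relCapacity_one_closedBall_le_of_lt (ha : 0 ≤ a) (hab : a < b)
    (hbΩ : Metric.closedBall (0 : EuclideanSpace ℝ (Fin (n + 1))) b ⊆ Ω) :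
    relCapacity 1 (Metric.closedBall 0 a) Ω ≤ ENNReal.ofReal (b ^ n) *
      (volume : Measure (EuclideanSpace ℝ (Fin (n + 1)))).toSphere univ := by
  have hab_sq : a ^ 2 < b ^ 2 := by gcongr
  refine (iInf₂_le (radialCutoff ha hab hbΩ) fun x hx => ?_).trans ?_
  · have hxa : ‖x‖ ≤ a := mem_closedBall_zero_iff.1 hx
    exact (cutoffProfile_eq_one hab_sq (by gcongr)).ge
  · simp only [ENNReal.rpow_one]
    refine (setLIntegral_le_lintegral _ _).trans ?_
    have hvar := lintegral_enorm_gradient_comp_norm_sq_le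
      (E := EuclideanSpace ℝ (Fin (n + 1))) finrank_euclideanSpace_fin
      ((contDiff_cutoffProfile a b).of_le (by norm_cast)) (antitone_cutoffProfile hab_sq.le)
      (ha.trans hab.le) fun _ => cutoffProfile_eq_zero hab_sq.le
    rwa [cutoffProfile_eq_one hab_sq (sq_nonneg a), ENNReal.ofReal_one, mul_one] at hvar

theorem relCapacity_one_closedBall_le {r : ℝ} (hr : 0 < r)
    (hrΩ : Metric.closedBall (0 : EuclideanSpace ℝ (Fin (n + 1))) r ⊆ Ω) :
    relCapacity 1 (Metric.closedBall 0 r) Ω ≤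
      μHE[n] (Metric.sphere (0 : EuclideanSpace ℝ (Fin (n + 1))) r) := by
  obtain ⟨δ, hδ, hδΩ⟩ := (isCompact_closedBall _ r).exists_cthickening_subset_open Ω.isOpen hrΩ
  rw [cthickening_closedBall hδ.le hr.le] at hδΩ
  rw [euclideanHausdorffMeasure_sphere finrank_euclideanSpace_fin hr]
  have hlim : Filter.Tendsto (fun b : ℝ => ENNReal.ofReal (b ^ n) *
      (volume : Measure (EuclideanSpace ℝ (Fin (n + 1)))).toSphere univ)
      (nhdsWithin r (Ioi r)) (nhds (ENNReal.ofReal (r ^ n) *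
        (volume : Measure (EuclideanSpace ℝ (Fin (n + 1)))).toSphere univ)) :=
    (ENNReal.Tendsto.mul_const ((ENNReal.continuous_ofReal.comp (continuous_pow n)).tendsto r)
      (Or.inr (measure_ne_top _ _))).mono_left nhdsWithin_le_nhds
  refine ge_of_tendsto hlim ?_
  filter_upwards [Ioo_mem_nhdsGT (lt_add_of_pos_left r hδ)] with b hb
  exact relCapacity_one_closedBall_le_of_lt hr.le hb.1
    ((Metric.closedBall_subset_closedBall hb.2.le).trans hδΩ)

end Cutoff

/-! ### Sharp constant and Cheeger constant -/

section TestFunction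

variable {N : ℕ} {Ω : Opens (EuclideanSpace ℝ (Fin N))}

theorem testFunction_contDiff_one (φ : 𝓓(Ω, ℝ)) : ContDiff ℝ 1 φ :=
  φ.contDiff.of_le (by norm_cast)

theorem testFunction_continuous_gradient (φ : 𝓓(Ω, ℝ)) : Continuous (gradient φ) :=
  continuous_gradient_of_contDiff (testFunction_contDiff_one φ)

theorem testFunction_eq_zero_of_notMem (φ : 𝓓(Ω, ℝ)) {x : EuclideanSpace ℝ (Fin N)}
    (hx : x ∉ Ω) : φ x = 0 :=
  image_eq_zero_of_notMem_tsupport fun h => hx (φ.tsupport_subset h)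

theorem testFunction_hasCompactSupport_gradient (φ : 𝓓(Ω, ℝ)) : HasCompactSupport (gradient φ) :=
  φ.hasCompactSupport.mono' (support_gradient_subset_tsupport φ)

theorem testFunction_setLIntegral_enorm_gradient (φ : 𝓓(Ω, ℝ)) :
    ∫⁻ x in Ω, ‖gradient φ x‖ₑ = ∫⁻ x, ‖gradient φ x‖ₑ :=
  setLIntegral_eq_of_support_subset fun x hx => φ.tsupport_subset <|
    support_gradient_subset_tsupport φ fun h => hx (by simp only [h, enorm_zero])

theorem testFunction_lintegral_enorm_gradient_ne_top (φ : 𝓓(Ω, ℝ)) :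
    ∫⁻ x in Ω, ‖gradient φ x‖ₑ ≠ ⊤ := by
  rw [testFunction_setLIntegral_enorm_gradient]
  exact ((testFunction_continuous_gradient φ).integrable_of_hasCompactSupport
    (testFunction_hasCompactSupport_gradient φ)).2.ne

theorem testFunction_eq_zero_of_fderiv_eq_zero [NeZero N] {φ : 𝓓(Ω, ℝ)}
    (h : ∀ x, fderiv ℝ φ x = 0) : φ = 0 := by
  obtain ⟨y, hy⟩ := (ne_univ_iff_exists_notMem _).1 φ.hasCompactSupport.isCompact.ne_univ
  ext x
  rw [is_const_of_fderiv_eq_zero ((testFunction_contDiff_one φ).differentiable one_ne_zero) h x y]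
  exact image_eq_zero_of_notMem_tsupport hy

theorem testFunction_lintegral_enorm_gradient_ne_zero [NeZero N] {φ : 𝓓(Ω, ℝ)} (hφ : φ ≠ 0) :
    ∫⁻ x in Ω, ‖gradient φ x‖ₑ ≠ 0 := by
  refine fun h => hφ (testFunction_eq_zero_of_fderiv_eq_zero fun x => ?_)
  have hcont := (testFunction_continuous_gradient φ).enorm
  rw [testFunction_setLIntegral_enorm_gradient, lintegral_eq_zero_iff hcont.measurable] at h
  have hx := congrFun ((hcont.ae_eq_iff_eq volume continuous_const).1 h) x
  rwa [← norm_eq_zero, ← norm_gradient_eq_norm_fderiv, norm_eq_zero, ← enorm_eq_zero]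

theorem testFunction_isWeakGradient (φ : 𝓓(Ω, ℝ)) : IsWeakGradient Ω φ (gradient φ) := by
  intro ψ v
  have hinner : ∀ x, inner ℝ (gradient φ x) v = fderiv ℝ φ x v := fun x => by
    rw [← toDual_gradient, InnerProductSpace.toDual_apply_apply]
  have hderiv : ∀ χ : 𝓓(Ω, ℝ), Continuous fun x => fderiv ℝ χ x v := fun χ =>
    ((testFunction_contDiff_one χ).continuous_fderiv one_ne_zero).clm_apply continuous_const
  have hdiff : ∀ χ : 𝓓(Ω, ℝ), Differentiable ℝ χ := fun χ =>
    (testFunction_contDiff_one χ).differentiable one_ne_zero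
  rw [setIntegral_eq_integral_of_forall_compl_eq_zero fun x hx => by
      rw [testFunction_eq_zero_of_notMem φ hx, zero_mul],
    setIntegral_eq_integral_of_forall_compl_eq_zero fun x hx => by
      rw [testFunction_eq_zero_of_notMem ψ hx, mul_zero]]
  simp only [hinner]
  exact integral_mul_fderiv_eq_neg_fderiv_mul_of_integrable
    (((hderiv φ).mul ψ.continuous).integrable_of_hasCompactSupport ψ.hasCompactSupport.mul_left)
    ((φ.continuous.mul (hderiv ψ)).integrable_of_hasCompactSupport φ.hasCompactSupport.mul_right)
    ((φ.continuous.mul ψ.continuous).integrable_of_hasCompactSupport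
      φ.hasCompactSupport.mul_right)
    (fun x _ => hdiff φ x) (fun x _ => hdiff ψ x)

theorem testFunction_memSobolevZero (φ : 𝓓(Ω, ℝ)) : MemSobolevZero 1 Ω φ (gradient φ) where
  memLp := (φ.continuous.memLp_of_hasCompactSupport φ.hasCompactSupport).restrict _
  memLp_grad := ((testFunction_continuous_gradient φ).memLp_of_hasCompactSupport
    (testFunction_hasCompactSupport_gradient φ)).restrict _
  isWeakGradient := testFunction_isWeakGradient φ
  mem_closure ε hε := ⟨φ, by simpa using hε⟩

end TestFunction

theorem lintegral_enorm_le_lintegral_enorm_sub_add {α F : Type*} [MeasurableSpace α]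
    [NormedAddCommGroup F] {μ : Measure α} (f : α → F) {g : α → F}
    (hg : AEStronglyMeasurable g μ) :
    ∫⁻ x, ‖f x‖ₑ ∂μ ≤ ∫⁻ x, ‖f x - g x‖ₑ ∂μ + ∫⁻ x, ‖g x‖ₑ ∂μ := by
  rw [← lintegral_add_right' _ hg.enorm]
  exact lintegral_mono fun x => by simpa using enorm_add_le (f x - g x) (g x)

section Sobolev

variable {N : ℕ} {Ω : Opens (EuclideanSpace ℝ (Fin N))} {S : Set (EuclideanSpace ℝ (Fin N))}
  {K : ℝ≥0∞}

theorem MemSobolevZero.setLIntegral_enorm_le (hS : S ⊆ Ω) (hK : K ≠ ⊤)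
    (h : ∀ φ : 𝓓(Ω, ℝ), ∫⁻ x in S, ‖φ x‖ₑ ≤ K * ∫⁻ x in Ω, ‖gradient φ x‖ₑ)
    {u : EuclideanSpace ℝ (Fin N) → ℝ} {G : EuclideanSpace ℝ (Fin N) → EuclideanSpace ℝ (Fin N)}
    (hu : MemSobolevZero 1 Ω u G) : ∫⁻ x in S, ‖u x‖ₑ ≤ K * ∫⁻ x in Ω, ‖G x‖ₑ := by
  have happrox : ∀ ε : ℝ≥0∞, 0 < ε →
      ∫⁻ x in S, ‖u x‖ₑ ≤ K * (∫⁻ x in Ω, ‖G x‖ₑ) + (1 + K) * ε := by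
    intro ε hε
    obtain ⟨φ, hφ⟩ := hu.mem_closure ε hε
    simp only [eLpNorm_one_eq_lintegral_enorm] at hφ
    have hφu : ∫⁻ x in S, ‖u x - φ x‖ₑ ≤ ε :=
      (lintegral_mono_set hS).trans (le_self_add.trans hφ.le)
    have hφG : ∫⁻ x in Ω, ‖gradient φ x - G x‖ₑ ≤ ε := by
      simp only [enorm_sub_rev (gradient φ _)]
      exact le_add_self.trans hφ.le
    calc ∫⁻ x in S, ‖u x‖ₑ ≤ (∫⁻ x in S, ‖u x - φ x‖ₑ) + ∫⁻ x in S, ‖φ x‖ₑ :=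
          lintegral_enorm_le_lintegral_enorm_sub_add u φ.continuous.aestronglyMeasurable
      _ ≤ ε + K * ((∫⁻ x in Ω, ‖gradient φ x - G x‖ₑ) + ∫⁻ x in Ω, ‖G x‖ₑ) := by
          gcongr
          exact (h φ).trans (mul_le_mul_right
            (lintegral_enorm_le_lintegral_enorm_sub_add _ hu.memLp_grad.1) _)
      _ ≤ ε + K * (ε + ∫⁻ x in Ω, ‖G x‖ₑ) := by gcongr
      _ = K * (∫⁻ x in Ω, ‖G x‖ₑ) + (1 + K) * ε := by ring
  have hlim : Filter.Tendsto (fun ε : ℝ≥0∞ => K * (∫⁻ x in Ω, ‖G x‖ₑ) + (1 + K) * ε)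
      (nhdsWithin 0 (Ioi 0)) (nhds (K * (∫⁻ x in Ω, ‖G x‖ₑ) + (1 + K) * 0)) :=
    (tendsto_const_nhds.add (ENNReal.Tendsto.const_mul Filter.tendsto_id
      (Or.inr (by finiteness)))).mono_left nhdsWithin_le_nhds
  simpa using ge_of_tendsto hlim (eventually_nhdsWithin_of_forall happrox)

theorem sharpConstant_le_of_forall_testFunction (hS : S ⊆ Ω)
    (h : ∀ φ : 𝓓(Ω, ℝ), ∫⁻ x in S, ‖φ x‖ₑ ≤ K * ∫⁻ x in Ω, ‖gradient φ x‖ₑ) :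
    sharpConstant Ω S ≤ K := by
  obtain rfl | hK := eq_or_ne K ⊤
  · exact le_top
  · exact iSup_le fun u => iSup_le fun G => iSup_le fun hu => iSup_le fun _ =>
      ENNReal.div_le_of_le_mul (hu.setLIntegral_enorm_le hS hK h)

variable [NeZero N]

theorem setLIntegral_enorm_le_sharpConstant_mul (hS : S ⊆ Ω) (φ : 𝓓(Ω, ℝ)) :
    ∫⁻ x in S, ‖φ x‖ₑ ≤ sharpConstant Ω S * ∫⁻ x in Ω, ‖gradient φ x‖ₑ := by
  by_cases hφS : ∫⁻ x in S, ‖φ x‖ₑ = 0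
  · simp only [hφS, zero_le]
  have hφ : φ ≠ 0 := fun h => hφS (by simp [h])
  have hφΩ : ¬ φ =ᵐ[volume.restrict (Ω : Set (EuclideanSpace ℝ (Fin N)))] 0 := fun h => hφS <| by
    rw [lintegral_eq_zero_iff φ.continuous.enorm.measurable]
    filter_upwards [ae_restrict_of_ae_restrict_of_subset hS h] with x hx
    simp [hx]
  rw [← ENNReal.div_le_iff (testFunction_lintegral_enorm_gradient_ne_zero hφ)
    (testFunction_lintegral_enorm_gradient_ne_top φ)]
  exact le_iSup_of_le φ <| le_iSup_of_le (gradient φ) <|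
    le_iSup_of_le (testFunction_memSobolevZero φ) <| le_iSup_of_le hφΩ le_rfl

theorem iInf_testFunction_gradient_div_eq_inv_sharpConstant (hS : S ⊆ Ω) :
    ⨅ (φ : 𝓓(Ω, ℝ)) (_ : φ ≠ 0), (∫⁻ x in Ω, ‖gradient φ x‖ₑ) / ∫⁻ x in S, ‖φ x‖ₑ =
      (sharpConstant Ω S)⁻¹ := by
  have hinv : ∀ φ : 𝓓(Ω, ℝ), φ ≠ 0 → (∫⁻ x in Ω, ‖gradient φ x‖ₑ) / ∫⁻ x in S, ‖φ x‖ₑ =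
      ((∫⁻ x in S, ‖φ x‖ₑ) / ∫⁻ x in Ω, ‖gradient φ x‖ₑ)⁻¹ := fun φ hφ =>
    (ENNReal.inv_div (.inl (testFunction_lintegral_enorm_gradient_ne_top φ))
      (.inl (testFunction_lintegral_enorm_gradient_ne_zero hφ))).symm
  refine le_antisymm (ENNReal.le_inv_iff_le_inv.2 ?_) (le_iInf₂ fun φ hφ => ?_)
  · refine sharpConstant_le_of_forall_testFunction hS fun φ => ?_
    obtain rfl | hφ := eq_or_ne φ 0
    · simp
    rw [← ENNReal.div_le_iff (testFunction_lintegral_enorm_gradient_ne_zero hφ)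
      (testFunction_lintegral_enorm_gradient_ne_top φ), ENNReal.le_inv_iff_le_inv, ← hinv φ hφ]
    exact iInf₂_le φ hφ
  · rw [hinv φ hφ]
    exact ENNReal.inv_le_inv.2
      (ENNReal.div_le_of_le_mul (setLIntegral_enorm_le_sharpConstant_mul hS φ))

theorem volume_div_sharpConstant_le_relCapacity {A : Set (EuclideanSpace ℝ (Fin N))}
    (hSA : S ⊆ A) (hS : S ⊆ Ω) : volume S / sharpConstant Ω S ≤ relCapacity 1 A Ω := by
  refine le_iInf₂ fun φ hφ => ENNReal.div_le_of_le_mul' ?_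
  simp only [ENNReal.rpow_one]
  refine le_trans ?_ (setLIntegral_enorm_le_sharpConstant_mul hS φ)
  rw [← setLIntegral_one]
  refine setLIntegral_mono φ.continuous.enorm.measurable fun x hx => ?_
  have hφx : 1 ≤ φ x := hφ x (hSA hx)
  rwa [Real.enorm_of_nonneg (zero_le_one.trans hφx), ENNReal.one_le_ofReal]

end Sobolev

section Cheeger

variable {N : ℕ} {Ω : Opens (EuclideanSpace ℝ (Fin N))} {S : Set (EuclideanSpace ℝ (Fin N))}
  {r : ℝ}

theorem inv_le_cheegerRatio {K : ℝ≥0∞} {U : Set (EuclideanSpace ℝ (Fin N))}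
    (hUS : volume (U ∩ S) ≠ ⊤) (h : volume (U ∩ S) ≤ K * μHE[N - 1] (frontier U)) :
    K⁻¹ ≤ cheegerRatio S U := by
  rw [cheegerRatio]
  split_ifs with h0
  · exact le_top
  · rw [← ENNReal.inv_div (.inr hUS) (.inr h0)]
    exact ENNReal.inv_le_inv.2 (ENNReal.div_le_of_le_mul h)

theorem cheegerRatio_of_subset {U : Set (EuclideanSpace ℝ (Fin N))} (hS : volume S ≠ 0)
    (hSU : S ⊆ U) : cheegerRatio S U = μHE[N - 1] (frontier U) / volume S := by
  rw [cheegerRatio, inter_eq_right.2 hSU, if_neg hS]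

theorem isOpenSmoothBoundary_ball (hr : r ≠ 0) :
    IsOpenSmoothBoundary (Metric.ball (0 : EuclideanSpace ℝ (Fin N)) r) := by
  refine ⟨Metric.isOpen_ball, fun x hx => ⟨univ, isOpen_univ, mem_univ x,
    fun y => ‖y‖ ^ 2 - r ^ 2, ((contDiff_norm_sq ℝ).sub contDiff_const).contDiffOn, ?_, ?_, ?_⟩⟩
  all_goals
    have hxr : ‖x‖ = r := by rwa [frontier_ball _ hr, mem_sphere_zero_iff_norm] at hx
  · simp only [hxr, sub_self]
  · rw [((hasStrictFDerivAt_norm_sq x).hasFDerivAt.sub_const (r ^ 2)).fderiv]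
    intro h
    have := DFunLike.congr_fun h x
    simp [hxr, hr] at this
  · ext y
    simp [sq_lt_sq₀ (norm_nonneg y) (hxr ▸ norm_nonneg x)]

theorem isCheegerAdmissible_ball (hr : r ≠ 0)
    (hrΩ : Metric.closedBall (0 : EuclideanSpace ℝ (Fin N)) r ⊆ Ω) :
    IsCheegerAdmissible Ω (Metric.ball 0 r) :=
  ⟨isOpenSmoothBoundary_ball hr, Metric.isBounded_ball.isCompact_closure,
    Metric.closure_ball_subset_closedBall.trans hrΩ⟩

end Cheeger

section Shell

variable {n : ℕ} {r₁ r₂ : ℝ} {Ω : Opens (EuclideanSpace ℝ (Fin (n + 1)))}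

theorem shell_subset_of_closedBall_subset {N : ℕ} {A : Set (EuclideanSpace ℝ (Fin N))}
    (hA : Metric.closedBall 0 r₂ ⊆ A) : shell N r₁ r₂ ⊆ A :=
  (sdiff_subset.trans Metric.ball_subset_closedBall).trans hA

theorem volume_shell (hr₁ : 0 ≤ r₁) (hr₂ : 0 < r₂) :
    volume (shell (n + 1) r₁ r₂) = ENNReal.ofReal (shellFluxConstant n r₁ r₂) *
      μHE[n] (Metric.sphere (0 : EuclideanSpace ℝ (Fin (n + 1))) r₂) := by
  rw [shell_eq_preimage_norm, volume_preimage_norm_Ioo finrank_euclideanSpace_fin hr₁ hr₂]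

theorem volume_shell_ne_zero (hr₁ : 0 ≤ r₁) (hr₁₂ : r₁ < r₂) :
    volume (shell (n + 1) r₁ r₂) ≠ 0 := by
  rw [volume_shell hr₁ (hr₁.trans_lt hr₁₂)]
  exact mul_ne_zero (ENNReal.ofReal_pos.2 (shellFluxConstant_pos hr₁ hr₁₂)).ne'
    (euclideanHausdorffMeasure_sphere_ne_zero finrank_euclideanSpace_fin (hr₁.trans_lt hr₁₂))

theorem volume_shell_ne_top (N : ℕ) (r₁ r₂ : ℝ) : volume (shell N r₁ r₂) ≠ ⊤ :=
  (Metric.isBounded_ball.subset sdiff_subset).measure_lt_top.ne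

theorem volume_shell_div_euclideanHausdorffMeasure_sphere (hr₁ : 0 ≤ r₁) (hr₂ : 0 < r₂) :
    volume (shell (n + 1) r₁ r₂) / μHE[n] (Metric.sphere (0 : EuclideanSpace ℝ (Fin (n + 1))) r₂) =
      ENNReal.ofReal (shellFluxConstant n r₁ r₂) := by
  rw [volume_shell hr₁ hr₂, ENNReal.mul_div_cancel_right
    (euclideanHausdorffMeasure_sphere_ne_zero finrank_euclideanSpace_fin hr₂)
    (euclideanHausdorffMeasure_sphere_ne_top finrank_euclideanSpace_fin hr₂)]

theorem sharpConstant_shell_le (hr₁ : 0 ≤ r₁) (hr₁₂ : r₁ < r₂)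
    (hΩ : Metric.closedBall 0 r₂ ⊆ (Ω : Set (EuclideanSpace ℝ (Fin (n + 1))))) :
    sharpConstant Ω (shell (n + 1) r₁ r₂) ≤ ENNReal.ofReal (shellFluxConstant n r₁ r₂) := by
  refine sharpConstant_le_of_forall_testFunction (shell_subset_of_closedBall_subset hΩ) fun φ => ?_
  rw [testFunction_setLIntegral_enorm_gradient, shell_eq_preimage_norm]
  exact setLIntegral_shell_enorm_le finrank_euclideanSpace_fin hr₁ hr₁₂
    (testFunction_contDiff_one φ) φ.hasCompactSupport

theorem relCapacity_one_closedBall (hr₂ : 0 < r₂)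
    (hΩ : Metric.closedBall 0 r₂ ⊆ (Ω : Set (EuclideanSpace ℝ (Fin (n + 1))))) :
    relCapacity 1 (Metric.closedBall 0 r₂) Ω =
      μHE[n] (Metric.sphere (0 : EuclideanSpace ℝ (Fin (n + 1))) r₂) := by
  refine (relCapacity_one_closedBall_le hr₂ hΩ).antisymm ?_
  have hK := ENNReal.ofReal_pos.2 (shellFluxConstant_pos (n := n) le_rfl hr₂)
  calc μHE[n] (Metric.sphere (0 : EuclideanSpace ℝ (Fin (n + 1))) r₂)
      = volume (shell (n + 1) 0 r₂) / ENNReal.ofReal (shellFluxConstant n 0 r₂) := by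
        rw [volume_shell le_rfl hr₂, mul_comm,
          ENNReal.mul_div_cancel_right hK.ne' ENNReal.ofReal_ne_top]
    _ ≤ volume (shell (n + 1) 0 r₂) / sharpConstant Ω (shell (n + 1) 0 r₂) :=
        ENNReal.div_le_div_left (sharpConstant_shell_le le_rfl hr₂ hΩ) _
    _ ≤ relCapacity 1 (Metric.closedBall 0 r₂) Ω :=
        volume_div_sharpConstant_le_relCapacity (shell_subset_of_closedBall_subset subset_rfl)
          (shell_subset_of_closedBall_subset hΩ)

theorem sharpConstant_shell (hr₁ : 0 ≤ r₁) (hr₁₂ : r₁ < r₂)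
    (hΩ : Metric.closedBall 0 r₂ ⊆ (Ω : Set (EuclideanSpace ℝ (Fin (n + 1))))) :
    sharpConstant Ω (shell (n + 1) r₁ r₂) = volume (shell (n + 1) r₁ r₂) /
      μHE[n] (Metric.sphere (0 : EuclideanSpace ℝ (Fin (n + 1))) r₂) := by
  have hr₂ := hr₁.trans_lt hr₁₂
  refine le_antisymm ?_ (ENNReal.div_le_of_le_mul ?_)
  · rw [volume_shell_div_euclideanHausdorffMeasure_sphere hr₁ hr₂]
    exact sharpConstant_shell_le hr₁ hr₁₂ hΩ
  · rw [mul_comm, ← ENNReal.div_le_iff_le_mul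
      (.inr (euclideanHausdorffMeasure_sphere_ne_top finrank_euclideanSpace_fin hr₂))
      (.inr (euclideanHausdorffMeasure_sphere_ne_zero finrank_euclideanSpace_fin hr₂)),
      ← relCapacity_one_closedBall hr₂ hΩ]
    exact volume_div_sharpConstant_le_relCapacity (shell_subset_of_closedBall_subset subset_rfl)
      (shell_subset_of_closedBall_subset hΩ)

theorem inv_sharpConstant_shell (hr₁ : 0 ≤ r₁) (hr₁₂ : r₁ < r₂)
    (hΩ : Metric.closedBall 0 r₂ ⊆ (Ω : Set (EuclideanSpace ℝ (Fin (n + 1))))) :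
    (sharpConstant Ω (shell (n + 1) r₁ r₂))⁻¹ =
      μHE[n] (Metric.sphere (0 : EuclideanSpace ℝ (Fin (n + 1))) r₂) /
        volume (shell (n + 1) r₁ r₂) := by
  rw [sharpConstant_shell hr₁ hr₁₂ hΩ, ENNReal.inv_div
    (.inr (volume_shell_ne_top _ _ _)) (.inr (volume_shell_ne_zero hr₁ hr₁₂))]

theorem cheegerRatio_shell_ball (hr₁ : 0 ≤ r₁) (hr₁₂ : r₁ < r₂) :
    cheegerRatio (shell (n + 1) r₁ r₂) (Metric.ball 0 r₂) =
      μHE[n] (Metric.sphere (0 : EuclideanSpace ℝ (Fin (n + 1))) r₂) /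
        volume (shell (n + 1) r₁ r₂) := by
  rw [cheegerRatio_of_subset (volume_shell_ne_zero hr₁ hr₁₂) sdiff_subset, Nat.add_sub_cancel,
    frontier_ball _ (hr₁.trans_lt hr₁₂).ne']

theorem cheegerConstant_shell (hr₁ : 0 ≤ r₁) (hr₁₂ : r₁ < r₂)
    (hΩ : Metric.closedBall 0 r₂ ⊆ (Ω : Set (EuclideanSpace ℝ (Fin (n + 1))))) :
    cheegerConstant Ω (shell (n + 1) r₁ r₂) = (sharpConstant Ω (shell (n + 1) r₁ r₂))⁻¹ := by
  have hr₂ := hr₁.trans_lt hr₁₂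
  refine le_antisymm ?_ (le_iInf₂ fun U hU => ?_)
  · rw [inv_sharpConstant_shell hr₁ hr₁₂ hΩ, ← cheegerRatio_shell_ball hr₁ hr₁₂]
    exact iInf₂_le _ (isCheegerAdmissible_ball hr₂.ne' hΩ)
  · rw [sharpConstant_shell hr₁ hr₁₂ hΩ,
      volume_shell_div_euclideanHausdorffMeasure_sphere hr₁ hr₂]
    refine inv_le_cheegerRatio
      (measure_ne_top_of_subset inter_subset_right (volume_shell_ne_top _ _ _)) ?_
    rw [shell_eq_preimage_norm]
    exact volume_inter_shell_le_mul_euclideanHausdorffMeasure_frontier finrank_euclideanSpace_fin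
      hr₁ hr₁₂ (hU.2.1.isBounded.subset subset_closure)

end Shell

theorem mainTheorem6_general {N : ℕ} (hN : N ≠ 0) {r₁ r₂ : ℝ} (hr₁ : 0 ≤ r₁) (hr₁₂ : r₁ < r₂)
    {Ω : Opens (EuclideanSpace ℝ (Fin N))}
    (hΩ : Metric.closedBall 0 r₂ ⊆ (Ω : Set (EuclideanSpace ℝ (Fin N)))) :
    sharpConstant Ω (shell N r₁ r₂) =
        volume (shell N r₁ r₂) / relCapacity 1 (Metric.closedBall 0 r₂) Ω ∧
      volume (shell N r₁ r₂) / relCapacity 1 (Metric.closedBall 0 r₂) Ω =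
        volume (shell N r₁ r₂) /
          μHE[N - 1] (frontier (Metric.ball (0 : EuclideanSpace ℝ (Fin N)) r₂)) ∧
      (⨅ (φ : 𝓓(Ω, ℝ)) (_ : φ ≠ 0),
          (∫⁻ x in (Ω : Set (EuclideanSpace ℝ (Fin N))), ‖gradient φ x‖ₑ) /
            ∫⁻ x in shell N r₁ r₂, ‖φ x‖ₑ) = cheegerConstant Ω (shell N r₁ r₂) ∧
      cheegerConstant Ω (shell N r₁ r₂) =
        relCapacity 1 (Metric.closedBall 0 r₂) Ω / volume (shell N r₁ r₂) ∧
      cheegerConstant Ω (shell N r₁ r₂) =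
        μHE[N - 1] (frontier (Metric.ball (0 : EuclideanSpace ℝ (Fin N)) r₂)) /
          volume (shell N r₁ r₂) ∧
      IsCheegerAdmissible Ω (Metric.ball 0 r₂) ∧
      cheegerRatio (shell N r₁ r₂) (Metric.ball 0 r₂) = cheegerConstant Ω (shell N r₁ r₂) := by
  obtain ⟨n, rfl⟩ := Nat.exists_eq_add_one_of_ne_zero hN
  have hr₂ : 0 < r₂ := hr₁.trans_lt hr₁₂
  have hcap := relCapacity_one_closedBall hr₂ hΩ
  have hsharp := sharpConstant_shell hr₁ hr₁₂ hΩ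
  have hcheeger := cheegerConstant_shell hr₁ hr₁₂ hΩ
  have hinv := inv_sharpConstant_shell hr₁ hr₁₂ hΩ
  rw [Nat.add_sub_cancel, frontier_ball _ hr₂.ne', hcap]
  exact ⟨hsharp, rfl,
    (iInf_testFunction_gradient_div_eq_inv_sharpConstant
      (shell_subset_of_closedBall_subset hΩ)).trans hcheeger.symm,
    hcheeger.trans hinv, hcheeger.trans hinv, isCheegerAdmissible_ball hr₂.ne' hΩ,
    (cheegerRatio_shell_ball hr₁ hr₁₂).trans (hcheeger.trans hinv).symm⟩

theorem mainTheorem6 (N : ℕ) (hN : 2 ≤ N) (r₁ r₂ R : ℝ) (hr₁ : 0 < r₁) (hr₁₂ : r₁ < r₂)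
    (hr₂R : r₂ < R) :
    -- the sharp constant
    sharpConstant (centredBall N R) (shell N r₁ r₂) =
        volume (shell N r₁ r₂) /
          relCapacity 1 (Metric.closedBall 0 r₂) (centredBall N R) ∧
      volume (shell N r₁ r₂) / relCapacity 1 (Metric.closedBall 0 r₂) (centredBall N R) =
        volume (shell N r₁ r₂) /
          μHE[N - 1] (frontier (Metric.ball (0 : EuclideanSpace ℝ (Fin N)) r₂)) ∧
      -- the associated Cheeger-type constant
      (⨅ (φ : 𝓓(centredBall N R, ℝ)) (_ : φ ≠ 0),
          (∫⁻ x in (centredBall N R : Set (EuclideanSpace ℝ (Fin N))), ‖gradient φ x‖ₑ) /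
            ∫⁻ x in shell N r₁ r₂, ‖φ x‖ₑ) =
        cheegerConstant (centredBall N R) (shell N r₁ r₂) ∧
      cheegerConstant (centredBall N R) (shell N r₁ r₂) =
        relCapacity 1 (Metric.closedBall 0 r₂) (centredBall N R) / volume (shell N r₁ r₂) ∧
      cheegerConstant (centredBall N R) (shell N r₁ r₂) =
        μHE[N - 1] (frontier (Metric.ball (0 : EuclideanSpace ℝ (Fin N)) r₂)) /
          volume (shell N r₁ r₂) ∧
      -- the ball of radius `r₂` is admissible and optimal
      IsCheegerAdmissible (centredBall N R) (Metric.ball 0 r₂) ∧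
      cheegerRatio (shell N r₁ r₂) (Metric.ball 0 r₂) =
        cheegerConstant (centredBall N R) (shell N r₁ r₂) :=
  mainTheorem6_general (by omega) hr₁.le hr₁₂ (Metric.closedBall_subset_ball hr₂R)
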